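/- **Theorem 1 (deterministic approximate counting).** Graphs are finite, undirected and not necessarily simple: parallel edges and loops are allowed, and a loop contributes $2$ to the degree of its vertex. An orientation gives each edge one of its two directions (so a graph with $m$ edges has $2^m$ orientations, and a loop leaves its vertex in either direction); it is *sink-free* if every vertex has at least one outgoing edge. For a graph $G$ let $n$ and $m$ be its numbers of vertices and edges, and let $Z(G)$ be the number of sink-free orientations of $G$. There is a deterministic algorithm that, given a graph $G$ of minimum degree at least $3$, stored as an adjacency list (each vertex has an array with one entry (neighbour, edge label) per incident edge-end, in arbitrary order), and a rational number $\varepsilon=a/b$ with $0<\varepsilon<1$, given by natural numbers $a,b$, outputs a number $\widetilde Z$ with $$1-\varepsilon\le \frac{\widetilde Z}{Z(G)}\le 1+\varepsilon ,$$ and whose running time is $$O\!\left(\frac{n^{73}}{\varepsilon^{72}}\,\log\frac{n}{\varepsilon}\right)\qquad (n\ge 2),$$ where the implied constant is absolute; in particular it does not depend on $m$. Here the algorithm is a program of a random access machine with unit-cost instructions (constants, addition, truncated subtraction, multiplication, integer division, indirect load and store, jumps) on words of $O(\log(n+m+a+b))$ bits, and $\widetilde Z$ is output in binary floating point, as three words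 $M,E,F$ with $\widetilde Z=M\cdot 2^{E}/2^{F}$. -/

import Mathlib

/-! ### Multigraphs and sink-free orientations -/

/-- A finite undirected multigraph with vertices `0, …, n - 1` and edges `0, …, m - 1`.
Parallel edges and loops are allowed. The order in which the two endpoints of an edge are named
carries no meaning: it only serves as the reference with respect to which an orientation is
recorded. -/
structure MultiGraph (n m : ℕ) where
  endpoint : Fin m → Bool → Fin n

namespace MultiGraph

variable {n m : ℕ} (G : MultiGraph n m)

/-- The edge-ends located at the vertex `v`; a loop at `v` has both of its ends there. -/
def endsAt (v : Fin n) : Finset (Fin m × Bool) :=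
  Finset.univ.filter fun d => G.endpoint d.1 d.2 = v

/-- The degree of a vertex (a loop counts twice). -/
def degree (v : Fin n) : ℕ := (G.endsAt v).card

/-- An orientation chooses, for every edge, which of its two ends is the tail. In particular there
are `2 ^ m` orientations, and both directions of a loop at `v` leave `v`. -/
abbrev Orientation (_G : MultiGraph n m) : Type := Fin m → Bool

/-- The vertex `v` is a sink if no edge leaves it. -/
def IsSink (σ : G.Orientation) (v : Fin n) : Prop :=
  ∀ e : Fin m, G.endpoint e (σ e) ≠ v

instance (σ : G.Orientation) (v : Fin n) : Decidable (G.IsSink σ v) :=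
  inferInstanceAs (Decidable (∀ _, _))

/-- The number of sink-free orientations. -/
def numSFO : ℕ :=
  (Finset.univ.filter fun σ : G.Orientation => ∀ v, ¬ G.IsSink σ v).card

/-- An adjacency list of `G`: for every vertex `v`, a list, in arbitrary order, with one entry
`(neighbour, edge)` for each edge-end at `v`. -/
structure AdjList where
  list : Fin n → List (Fin n × Fin m)
  spec : ∀ v, (list v : Multiset (Fin n × Fin m)) =
    (G.endsAt v).val.map fun d => (G.endpoint d.1 (!d.2), d.1)

variable {G}

/-- The memory address at which the adjacency list of the vertex `i` starts (and that of the vertex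
`i - 1` ends). -/
def AdjList.offset (L : G.AdjList) (i : ℕ) : ℕ :=
  n + 5 + 2 * ∑ v : Fin n with v.val < i, (L.list v).length

/-- The input as a sequence of words: `n`, `m`, the numerator `a` and the denominator `b` of the
accuracy, the `n + 1` offsets, and the concatenated adjacency lists, two words per entry. -/
def AdjList.encode (L : G.AdjList) (a b : ℕ) : List ℕ :=
  [n, m, a, b] ++ (List.range (n + 1)).map L.offset ++
    (List.finRange n).flatMap fun v => (L.list v).flatMap fun p => [p.1.val, p.2.val]

end MultiGraph

/-! ### A random access machine -/

namespace RAM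

/-- Instructions. Arguments called `d`, `x`, `y` are register numbers; `k` is a constant and `l` a
position in the program. -/
inductive Instr : Type
  | const (d k : ℕ)
  | add (d x y : ℕ)
  | sub (d x y : ℕ)
  | mul (d x y : ℕ)
  | div (d x y : ℕ)
  | load (d x : ℕ)
  | store (x y : ℕ)
  | jump (l : ℕ)
  | jlt (x y l : ℕ)
  | halt

/-- A program is a finite list of instructions. -/
abbrev Program : Type := List Instr

/-- A configuration: program counter, registers, memory. -/
structure Config where
  pc : ℕ
  reg : ℕ → ℕ
  mem : ℕ → ℕ

/-- Put the value `z` into the register `d` and go to the next instruction. -/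
def Config.set (c : Config) (d z : ℕ) : Config :=
  { pc := c.pc + 1, reg := Function.update c.reg d z, mem := c.mem }

/-- The effect of one instruction. Subtraction is truncated at zero, division is rounded down (with
quotient zero if the divisor is zero), `load` and `store` use the contents of the register `x` as
the memory address, and `jlt` jumps if the contents of `x` are less than those of `y`. -/
def Instr.exec : Instr → Config → Config
  | .const d k, c => c.set d k
  | .add d x y, c => c.set d (c.reg x + c.reg y)
  | .sub d x y, c => c.set d (c.reg x - c.reg y)
  | .mul d x y, c => c.set d (c.reg x * c.reg y)
  | .div d x y, c => c.set d (c.reg x / c.reg y)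
  | .load d x, c => c.set d (c.mem (c.reg x))
  | .store x y, c => { c with pc := c.pc + 1, mem := Function.update c.mem (c.reg x) (c.reg y) }
  | .jump l, c => { c with pc := l }
  | .jlt x y l, c => { c with pc := if c.reg x < c.reg y then l else c.pc + 1 }
  | .halt, c => c

/-- The instruction about to be executed; outside the program this is `halt`. -/
def current (P : Program) (c : Config) : Instr := P.getD c.pc .halt

/-- One step of the program `P`. -/
def step (P : Program) (c : Config) : Config := (current P c).exec c

/-- The machine has stopped. -/
def Halted (P : Program) (c : Config) : Prop := current P c = .halt

/-- The initial configuration: the input is in the memory from address zero on, everything else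
is zero. -/
def init (input : List ℕ) : Config :=
  { pc := 0, reg := fun _ => 0, mem := fun i => input.getD i 0 }

/-- The configuration of `P` on the given input after `s` steps. -/
def run (P : Program) (input : List ℕ) (s : ℕ) : Config := (step P)^[s] (init input)

/-- All numbers held by the registers and the memory during the first `t` steps are less than `B`,
i.e. words of `⌈log₂ B⌉` bits suffice. -/
def FitsInWords (P : Program) (input : List ℕ) (t B : ℕ) : Prop :=
  ∀ s ≤ t, ∀ i, (run P input s).reg i < B ∧ (run P input s).mem i < B

/-- The number `M * 2 ^ E / 2 ^ F` represented by the output registers `M`, `E`, `F`, which are the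
registers 0, 1, 2 (binary floating point). -/
noncomputable def Config.output (c : Config) : ℝ :=
  (c.reg 0 : ℝ) * 2 ^ c.reg 1 / 2 ^ c.reg 2

end RAM

/-! ### Counting orientations that avoid sinks in a set -/

/-! Write r(S, v) = avoid(S ∪ {v}) / avoid(S), where avoid(S) counts the orientations without sinks
in S (`ratio`, `avoid`). Inserting the vertices one at a time gives Z(G) = 2^m · ∏ r({0, …, j-1},
j), so it suffices to estimate each factor with relative error at most ε/(2n).

A loop at v forces r(S, v) = 1. Otherwise v is a sink exactly when its d edges all point to it, and
then no neighbour is a sink, so r(S, v) = 1 - 2^(-d) · avoid(S \ N(v)) / avoid(S) (`avoid_insert`).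
Deleting the neighbours from S one by one writes the last quotient as a product of terms 1/r(S', u)
in which u has the neighbour v outside S'. For minimum degree 3 such r(S', u) are at least 4/5, and
all r are at least 3/4 (`avoid_pos_and_ratio`).

This recursion contracts: an error η in the factors becomes at most (5/8)^d · d · (5/4) · η ≤
(15/16)^(d-2) · η (`abs_sweep_sub_le`, `weight_le_pow`). `approx` therefore charges d - 2 to a
budget k for a vertex of degree d, and answers 1 once d - 2 ≥ k. With fixed-point numbers of scale Q
the total error is at most (15/16)^k + 60/Q (`abs_approx_sub_ratio_le`), and the time is O(n · 4^k)
(`one_add_mul_four_pow_le`). A budget k of order log(n/ε) makes this polynomial. Lists with more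
than k + 1 entries are never read, so m does not enter.

The program `counter` runs the recursion on an explicit stack. It is verified by symbolic execution:
`evaluates` treats the recursion, `ok_main_loop` the product over the vertices. -/

/-- Prescribing the coordinates in `E` divides the number of solutions of a condition that does not
depend on them by `2 ^ #E`. -/
theorem card_filter_prescribed {m : ℕ} (p : (Fin m → Bool) → Prop) [DecidablePred p]
    (τ : Fin m → Bool) (E : Finset (Fin m))
    (hp : ∀ σ, ∀ e ∈ E, ∀ b, p (Function.update σ e b) ↔ p σ) :
    2 ^ E.card * (Finset.univ.filter fun σ => p σ ∧ ∀ e ∈ E, σ e = τ e).card =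
      (Finset.univ.filter p).card := by
  induction E using Finset.induction_on with
  | empty => simp
  | insert e E he ih =>
    rw [← ih fun σ e' h' b => hp σ e' (Finset.mem_insert_of_mem h') b,
      Finset.card_insert_of_notMem he, pow_succ, mul_assoc]
    congr 1
    have hsplit := Finset.card_filter_add_card_filter_not
      (s := Finset.univ.filter fun σ => p σ ∧ ∀ e ∈ E, σ e = τ e) (fun σ => σ e = τ e)
    rw [← hsplit, two_mul, Finset.filter_filter, Finset.filter_filter]
    congr 1
    · congr 1
      ext σ
      simp only [Finset.mem_filter, Finset.mem_univ, true_and, Finset.forall_mem_insert]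
      tauto
    -- Overwriting the coordinate `e` matches the two halves, since `p` does not depend on it.
    · refine Finset.card_bij' (fun σ _ => Function.update σ e (!τ e))
        (fun σ _ => Function.update σ e (τ e)) ?_ ?_ ?_ ?_
      · intro σ hσ
        simp only [Finset.mem_filter, Finset.mem_univ, true_and, Finset.forall_mem_insert] at hσ ⊢
        refine ⟨⟨(hp σ e (Finset.mem_insert_self _ _) _).2 hσ.1, fun e' h' => ?_⟩, by simp⟩
        rw [Function.update_of_ne (ne_of_mem_of_not_mem h' he)]
        exact hσ.2.2 e' h'
      · intro σ hσ
        simp only [Finset.mem_filter, Finset.mem_univ, true_and, Finset.forall_mem_insert] at hσ ⊢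
        refine ⟨(hp σ e (Finset.mem_insert_self _ _) _).2 hσ.1.1, by simp, fun e' h' => ?_⟩
        rw [Function.update_of_ne (ne_of_mem_of_not_mem h' he)]
        exact hσ.1.2 e' h'
      · intro σ hσ
        simp only [Finset.mem_filter, Finset.mem_univ, true_and, Finset.forall_mem_insert] at hσ
        simp [← hσ.2.1]
      · intro σ hσ
        simp only [Finset.mem_filter, Finset.mem_univ, true_and] at hσ
        have : σ e = !τ e := by
          have := hσ.2
          revert this
          cases σ e <;> cases τ e <;> simp
        simp [← this]

namespace MultiGraph

variable {n m : ℕ} (G : MultiGraph n m)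

/-- The number of orientations for which no vertex of `S` is a sink. -/
def avoid (S : Finset (Fin n)) : ℕ :=
  (Finset.univ.filter fun σ : G.Orientation => ∀ v ∈ S, ¬ G.IsSink σ v).card

/-- The neighbours of a vertex; a vertex with a loop is its own neighbour. -/
def nbrs (v : Fin n) : Finset (Fin n) :=
  (G.endsAt v).image fun d => G.endpoint d.1 (!d.2)

theorem mem_nbrs {u v : Fin n} :
    u ∈ G.nbrs v ↔ ∃ e b, G.endpoint e b = v ∧ G.endpoint e (!b) = u := by
  simp [nbrs, endsAt]

theorem mem_nbrs_comm {u v : Fin n} : u ∈ G.nbrs v ↔ v ∈ G.nbrs u := by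
  rw [mem_nbrs, mem_nbrs]
  constructor <;> rintro ⟨e, b, h, h'⟩ <;> exact ⟨e, !b, h', by simpa using h⟩

theorem card_nbrs_le (v : Fin n) : (G.nbrs v).card ≤ G.degree v := Finset.card_image_le

theorem not_isSink_of_loop {v : Fin n} (hv : v ∈ G.nbrs v) (σ : G.Orientation) :
    ¬ G.IsSink σ v := by
  obtain ⟨e, b, h, h'⟩ := G.mem_nbrs.1 hv
  intro hs
  rcases Bool.eq_or_eq_not (σ e) b with hb | hb
  · exact hs e (hb ▸ h)
  · exact hs e (hb ▸ h')

theorem not_isSink_of_nbr {u v : Fin n} (hu : u ∈ G.nbrs v) {σ : G.Orientation}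
    (hs : G.IsSink σ v) : ¬ G.IsSink σ u := by
  obtain ⟨e, b, h, h'⟩ := G.mem_nbrs.1 hu
  intro hs'
  rcases Bool.eq_or_eq_not (σ e) b with hb | hb
  · exact hs e (hb ▸ h)
  · exact hs' e (hb ▸ h')

theorem avoid_empty : G.avoid ∅ = 2 ^ m := by
  simp [avoid, Orientation]

theorem avoid_univ : G.avoid Finset.univ = G.numSFO := by
  simp [avoid, numSFO]

theorem avoid_insert_of_loop {v : Fin n} (hv : v ∈ G.nbrs v) (S : Finset (Fin n)) :
    G.avoid (insert v S) = G.avoid S := by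
  unfold avoid
  congr 1
  ext σ
  simp [G.not_isSink_of_loop hv σ]

/-- The number of orientations for which `v` is a sink, but no vertex of `T` is. -/
theorem card_sink_avoid {v : Fin n} (hv : v ∉ G.nbrs v) {T : Finset (Fin n)} (hvT : v ∉ T)
    (hT : ∀ u ∈ T, u ∉ G.nbrs v) :
    2 ^ G.degree v * (Finset.univ.filter fun σ : G.Orientation =>
      (∀ u ∈ T, ¬ G.IsSink σ u) ∧ G.IsSink σ v).card = G.avoid T := by
  classical
  -- Without a loop, distinct ends at `v` belong to distinct edges, so the degree is the number of
  -- edges prescribed.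
  have hinj : Set.InjOn (fun d : Fin m × Bool => d.1) (G.endsAt v) := by
    rintro ⟨e, b⟩ h ⟨e', b'⟩ h' (rfl : e = e')
    simp only [endsAt, Finset.coe_filter, Finset.mem_univ, true_and, Set.mem_ofPred_eq] at h h'
    by_contra hne
    have hb : b' = !b := by
      revert hne
      cases b <;> cases b' <;> simp
    exact hv (G.mem_nbrs.2 ⟨e, b, h, hb ▸ h'⟩)
  -- The direction towards `v`: the tail is the end that is not at `v`.
  let τ : Fin m → Bool := fun e => decide (G.endpoint e true ≠ v)
  have key := card_filter_prescribed (fun σ : G.Orientation => ∀ u ∈ T, ¬ G.IsSink σ u) τ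
    ((G.endsAt v).image fun d => d.1) ?_
  · rw [Finset.card_image_of_injOn hinj] at key
    rw [avoid, ← key, degree]
    congr 2
    ext σ
    simp only [Finset.mem_filter, Finset.mem_univ, true_and, and_congr_right_iff,
      Finset.mem_image, endsAt]
    intro _
    constructor
    · rintro hs e ⟨⟨e', b⟩, h, rfl⟩
      have hse := hs e'
      simp only at h
      by_cases ht : G.endpoint e' true = v
      · have : σ e' ≠ true := fun hh => hse (hh ▸ ht)
        simp [τ, ht, this]
      · cases b
        · have : σ e' ≠ false := fun hh => hse (hh ▸ h)
          simp [τ, ht, this]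
        · exact absurd h ht
    · intro hs e he
      have hse := hs e ⟨(e, σ e), he, rfl⟩
      by_cases ht : G.endpoint e true = v
      · have h1 : σ e = false := by simp [hse, τ, ht]
        exact hv (G.mem_nbrs.2 ⟨e, true, ht, by simpa [h1] using he⟩)
      · have h1 : σ e = true := by simp [hse, τ, ht]
        exact ht (h1 ▸ he)
  · intro σ e he b
    obtain ⟨⟨e', b'⟩, h, rfl⟩ := Finset.mem_image.1 he
    simp only [endsAt, Finset.mem_filter, Finset.mem_univ, true_and] at h
    have hne : ∀ u ∈ T, ∀ c, G.endpoint e' c ≠ u := by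
      intro u hu c hc
      rcases Bool.eq_or_eq_not c b' with rfl | rfl
      · exact hvT (by rw [← h, hc]; exact hu)
      · exact hT u hu (G.mem_nbrs.2 ⟨e', b', h, hc⟩)
    refine forall₂_congr fun u hu => not_congr (forall_congr' fun e'' => ?_)
    by_cases hee : e'' = e'
    · subst hee
      simp [hne u hu]
    · rw [Function.update_of_ne hee]

/-- When `v` is a sink its neighbours are not, so their constraints may be dropped; the remaining
constraints do not involve the edges at `v`. -/
theorem avoid_insert {v : Fin n} (hv : v ∉ G.nbrs v) {S : Finset (Fin n)} (hvS : v ∉ S) :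
    (G.avoid (insert v S) : ℝ) = G.avoid S - G.avoid (S \ G.nbrs v) / 2 ^ G.degree v := by
  have h1 := G.card_sink_avoid hv (T := S \ G.nbrs v) (by simp [hvS]) (by simp)
  have h2 := Finset.card_filter_add_card_filter_not
    (s := Finset.univ.filter fun σ : G.Orientation => ∀ u ∈ S, ¬ G.IsSink σ u)
    (fun σ => G.IsSink σ v)
  rw [Finset.filter_filter, Finset.filter_filter] at h2
  have h3 : (Finset.univ.filter fun σ : G.Orientation =>
      (∀ u ∈ S \ G.nbrs v, ¬ G.IsSink σ u) ∧ G.IsSink σ v) =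
      Finset.univ.filter fun σ : G.Orientation => (∀ u ∈ S, ¬ G.IsSink σ u) ∧ G.IsSink σ v := by
    ext σ
    simp only [Finset.mem_filter, Finset.mem_univ, true_and, Finset.mem_sdiff]
    constructor
    · rintro ⟨h, hs⟩
      refine ⟨fun u hu => ?_, hs⟩
      by_cases hun : u ∈ G.nbrs v
      · exact G.not_isSink_of_nbr hun hs
      · exact h u ⟨hu, hun⟩
    · rintro ⟨h, hs⟩
      exact ⟨fun u hu => h u hu.1, hs⟩
  have h4 : (Finset.univ.filter fun σ : G.Orientation =>
      (∀ u ∈ S, ¬ G.IsSink σ u) ∧ ¬ G.IsSink σ v).card = G.avoid (insert v S) := by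
    unfold avoid
    congr 1
    ext σ
    simp [and_comm]
  rw [h3] at h1
  rw [h4] at h2
  have h5 : G.avoid S = _ := h2.symm
  rw [← h1, h5]
  push_cast
  field_simp
  ring

/-- The three claims need each other and are proved together by induction on the size of `S`. Each
neighbour u of v removed from S has v outside the smaller set, so the 4/5 bound applies there and
the removal costs a factor at most 5/4. A neighbour `w ∉ S` costs nothing, which saves one factor
and improves 3/4 to 4/5. -/
theorem avoid_pos_and_ratio (hdeg : ∀ v, 3 ≤ G.degree v) (S : Finset (Fin n)) :
    0 < G.avoid S ∧ ∀ v ∉ S, (3 / 4 : ℝ) * G.avoid S ≤ G.avoid (insert v S) ∧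
      (∀ w ∈ G.nbrs v, w ∉ S → (4 / 5 : ℝ) * G.avoid S ≤ G.avoid (insert v S)) := by
  induction hs : S.card using Nat.strong_induction_on generalizing S with
  | _ s ih =>
  subst hs
  have hpos : 0 < G.avoid S := by
    rcases S.eq_empty_or_nonempty with rfl | ⟨u, hu⟩
    · rw [avoid_empty]; positivity
    · have h := ih _ (Finset.card_erase_lt_of_mem hu) _ rfl
      have h' := (h.2 u (Finset.notMem_erase u S)).1
      rw [Finset.insert_erase hu] at h'
      have : (0 : ℝ) < G.avoid (S.erase u) := by exact_mod_cast h.1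
      have : (0 : ℝ) < G.avoid S := by linarith
      exact_mod_cast this
  refine ⟨hpos, fun v hvS => ?_⟩
  have hremove : ∀ T ⊆ G.nbrs v,
      (G.avoid (S \ T) : ℝ) ≤ (5 / 4) ^ (T ∩ S).card * G.avoid S := by
    intro T
    induction T using Finset.induction_on with
    | empty => simp
    | insert u T hu ihT =>
      intro hT
      have h1 := ihT ((Finset.subset_insert _ _).trans hT)
      by_cases huS : u ∈ S
      · have huST : u ∈ S \ T := by simp [huS, hu]
        have hcard : ((S \ T).erase u).card < S.card :=
          (Finset.card_erase_lt_of_mem huST).trans_le (Finset.card_le_card Finset.sdiff_subset)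
        have h2 := ((ih _ hcard _ rfl).2 u (Finset.notMem_erase _ _)).2 v
          (G.mem_nbrs_comm.1 (hT (Finset.mem_insert_self _ _))) (by simp [hvS])
        rw [Finset.insert_erase huST] at h2
        have h3 : S \ insert u T = (S \ T).erase u := by
          ext x; simp only [Finset.mem_sdiff, Finset.mem_insert, Finset.mem_erase]; tauto
        rw [h3, Finset.insert_inter_of_mem huS, Finset.card_insert_of_notMem (by simp [hu]),
          pow_succ]
        nlinarith
      · have h3 : S \ insert u T = S \ T := by
          ext x
          simp only [Finset.mem_sdiff, Finset.mem_insert]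
          constructor
          · tauto
          · rintro ⟨hx, hxT⟩
            exact ⟨hx, by rintro (rfl | h) <;> contradiction⟩
        rw [h3, Finset.insert_inter_of_notMem huS]
        exact h1
  have hposR : (0 : ℝ) < G.avoid S := by exact_mod_cast hpos
  by_cases hloop : v ∈ G.nbrs v
  · rw [G.avoid_insert_of_loop hloop]
    exact ⟨by linarith, fun _ _ _ => by linarith⟩
  · rw [G.avoid_insert hloop hvS]
    have hr := hremove _ subset_rfl
    have hd := hdeg v
    have hbound : ∀ c : ℕ, (G.nbrs v ∩ S).card ≤ c →
        (G.avoid (S \ G.nbrs v) : ℝ) / 2 ^ G.degree v ≤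
          (5 / 4) ^ c / 2 ^ G.degree v * G.avoid S := by
      intro c hc
      rw [div_mul_eq_mul_div]
      gcongr
      exact hr.trans (by gcongr; norm_num)
    constructor
    · have h := hbound (G.degree v)
        ((Finset.card_le_card Finset.inter_subset_left).trans (G.card_nbrs_le v))
      rw [← div_pow] at h
      -- All neighbours may lie in `S`: (5/8)^3 = 125/512 < 1/4.
      have h2 : (5 / 4 / 2 : ℝ) ^ G.degree v ≤ (5 / 4 / 2) ^ 3 :=
        pow_le_pow_of_le_one (by norm_num) (by norm_num) hd
      have h3 : (5 / 4 / 2 : ℝ) ^ G.degree v ≤ 1 / 4 := h2.trans (by norm_num)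
      nlinarith
    · intro w hw hwS
      have hlt : (G.nbrs v ∩ S).card < G.degree v :=
        (Finset.card_lt_card ⟨Finset.inter_subset_left, fun h =>
          hwS (Finset.mem_inter.1 (h hw)).2⟩).trans_le (G.card_nbrs_le v)
      obtain ⟨d, hd'⟩ : ∃ d, G.degree v = d + 1 := ⟨G.degree v - 1, by omega⟩
      have h := hbound d (by omega)
      rw [hd', pow_succ, ← div_div ((5 / 4 : ℝ) ^ d), ← div_pow] at h
      -- One factor 5/4 is missing: (5/8)^2 / 2 = 25/128 < 1/5.
      have h2 : (5 / 4 / 2 : ℝ) ^ d ≤ (5 / 4 / 2) ^ 2 :=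
        pow_le_pow_of_le_one (by norm_num) (by norm_num) (by omega)
      have h3 : (5 / 4 / 2 : ℝ) ^ d / 2 ≤ 1 / 5 := by
        have : (5 / 4 / 2 : ℝ) ^ 2 ≤ 2 / 5 := by norm_num
        linarith
      rw [hd', pow_succ]
      nlinarith

theorem avoid_pos (hdeg : ∀ v, 3 ≤ G.degree v) (S : Finset (Fin n)) : (0 : ℝ) < G.avoid S := by
  exact_mod_cast (G.avoid_pos_and_ratio hdeg S).1

/-- The probability that `v` is not a sink, given that no vertex of `S` is one. -/
noncomputable def ratio (S : Finset (Fin n)) (v : Fin n) : ℝ :=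
  G.avoid (insert v S) / G.avoid S

theorem avoid_insert_eq (hdeg : ∀ v, 3 ≤ G.degree v) (S : Finset (Fin n)) (v : Fin n) :
    (G.avoid (insert v S) : ℝ) = G.ratio S v * G.avoid S := by
  rw [ratio, div_mul_cancel₀ _ (G.avoid_pos hdeg S).ne']

theorem three_quarters_le_ratio (hdeg : ∀ v, 3 ≤ G.degree v) {S : Finset (Fin n)} {v : Fin n}
    (hv : v ∉ S) : 3 / 4 ≤ G.ratio S v := by
  rw [ratio, le_div_iff₀ (G.avoid_pos hdeg S)]
  exact ((G.avoid_pos_and_ratio hdeg S).2 v hv).1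

theorem four_fifths_le_ratio (hdeg : ∀ v, 3 ≤ G.degree v) {S : Finset (Fin n)} {v w : Fin n}
    (hv : v ∉ S) (hw : w ∈ G.nbrs v) (hwS : w ∉ S) : 4 / 5 ≤ G.ratio S v := by
  rw [ratio, le_div_iff₀ (G.avoid_pos hdeg S)]
  exact ((G.avoid_pos_and_ratio hdeg S).2 v hv).2 w hw hwS

theorem ratio_of_loop (hdeg : ∀ v, 3 ≤ G.degree v) {S : Finset (Fin n)} {v : Fin n}
    (hv : v ∈ G.nbrs v) : G.ratio S v = 1 := by
  rw [ratio, G.avoid_insert_of_loop hv, div_self (G.avoid_pos hdeg S).ne']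

theorem ratio_of_loopless (hdeg : ∀ v, 3 ≤ G.degree v) {S : Finset (Fin n)} {v : Fin n}
    (hv : v ∉ G.nbrs v) (hvS : v ∉ S) :
    G.ratio S v = 1 - G.avoid (S \ G.nbrs v) / G.avoid S / 2 ^ G.degree v := by
  have := (G.avoid_pos hdeg S).ne'
  rw [ratio, G.avoid_insert hv hvS]
  field_simp

end MultiGraph

/-! ### Approximating the conditional probabilities -/

namespace MultiGraph

variable {n m : ℕ} {G : MultiGraph n m}

theorem AdjList.length_list (L : G.AdjList) (v : Fin n) : (L.list v).length = G.degree v := by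
  have := congrArg Multiset.card (L.spec v)
  simpa [degree] using this

theorem AdjList.exists_mem_list (L : G.AdjList) {u v : Fin n} :
    (∃ p ∈ L.list v, p.1 = u) ↔ u ∈ G.nbrs v := by
  have h : ∀ p, p ∈ L.list v ↔ p ∈ (L.list v : Multiset (Fin n × Fin m)) := fun p => by simp
  simp only [h, L.spec v, nbrs, Multiset.mem_map, Finset.mem_image, Finset.mem_val]
  constructor
  · rintro ⟨_, ⟨d, hd, rfl⟩, hu⟩
    exact ⟨d, hd, hu⟩
  · rintro ⟨d, hd, hu⟩
    exact ⟨_, ⟨d, hd, rfl⟩, hu⟩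

/-- Run through an adjacency list of the vertex `v`, halving `y` for each entry and dividing it by the
approximation `g` of the conditional probability, scaled by `Q`, for each neighbour that is still
in `S`. A loop annihilates `y`. -/
def sweep (g : Finset (Fin n) → Fin n → ℕ) (Q : ℕ) (v : Fin n) :
    List (Fin n × Fin m) → Finset (Fin n) → ℕ → ℕ
  | [], _, y => y
  | p :: l, S, y =>
    if p.1 = v then sweep g Q v l S 0
    else if p.1 ∈ S then
      sweep g Q v l (S.erase p.1) (y / 2 * Q / g (S.erase p.1) p.1)
    else sweep g Q v l S (y / 2)

/-- The approximation of `Q * G.ratio S v`, where the effort is limited by `k`. -/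
def approx (adj : Fin n → List (Fin n × Fin m)) (Q k : ℕ) (S : Finset (Fin n)) (v : Fin n) : ℕ :=
  -- The second alternative only secures termination; it never occurs in minimum degree 3.
  if _h : k + 2 ≤ (adj v).length ∨ (adj v).length < 3 then Q
  else Q - sweep (approx adj Q (k + 2 - (adj v).length)) Q v (adj v) S Q
termination_by k

theorem approx_le (adj : Fin n → List (Fin n × Fin m)) (Q k : ℕ) (S : Finset (Fin n))
    (v : Fin n) : approx adj Q k S v ≤ Q := by
  rw [approx]
  split_ifs
  · exact le_rfl
  · exact Nat.sub_le _ _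

theorem sweep_zero (g : Finset (Fin n) → Fin n → ℕ) (Q : ℕ) (v : Fin n)
    (l : List (Fin n × Fin m)) (S : Finset (Fin n)) : sweep g Q v l S 0 = 0 := by
  induction l generalizing S with
  | nil => rfl
  | cons p l ih => simp [sweep, ih]

/-- Zero is absorbing, so a loop anywhere in the list makes `approx` return exactly `Q`, the scaled
value of r = 1. -/
theorem sweep_of_loop (g : Finset (Fin n) → Fin n → ℕ) (Q : ℕ) (v : Fin n)
    (l : List (Fin n × Fin m)) (hl : ∃ p ∈ l, p.1 = v) (S : Finset (Fin n)) (y : ℕ) :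
    sweep g Q v l S y = 0 := by
  induction l generalizing S y with
  | nil => simp at hl
  | cons p l ih =>
    rw [sweep]
    split_ifs with h1 h2
    · exact sweep_zero ..
    all_goals
      refine ih ?_ _ _
      obtain ⟨p', hp', h⟩ := hl
      rcases List.mem_cons.1 hp' with rfl | hp'
      · exact absurd h h1
      · exact ⟨p', hp', h⟩

/-! ### Lower bounds for the approximations -/

/-- What is needed of the approximations for the neighbours of `v`. -/
def LowerBound (G : MultiGraph n m) (g : Finset (Fin n) → Fin n → ℕ) (Q : ℕ) (v : Fin n) : Prop :=
  ∀ S, ∀ u ∈ G.nbrs v, u ∉ S → v ∉ S → (4 / 5 : ℝ) * Q ≤ g S u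

theorem half_cast_le (y : ℕ) : ((y / 2 : ℕ) : ℝ) ≤ y / 2 := by
  simpa using Nat.cast_div_le (α := ℝ) (m := y) (n := 2)

theorem sub_le_cast_sub (x y : ℕ) : (x : ℝ) - y ≤ ((x - y : ℕ) : ℝ) := by
  have : x ≤ x - y + y := by omega
  have : (x : ℝ) ≤ ((x - y : ℕ) : ℝ) + y := by exact_mod_cast this
  linarith

theorem sub_one_le_cast_div (x y : ℕ) : (x : ℝ) / y - 1 ≤ ((x / y : ℕ) : ℝ) := by
  rw [← Nat.floor_div_eq_div (K := ℝ)]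
  exact (Nat.sub_one_lt_floor _).le

/-- 5/8 is half of 5/4. Both truncations round down, hence no rounding term. -/
theorem cast_div_child_le {Q x y : ℕ} (hx : (4 / 5 : ℝ) * Q ≤ x) :
    ((y / 2 * Q / x : ℕ) : ℝ) ≤ 5 / 8 * y := by
  rcases Nat.eq_zero_or_pos Q with rfl | hQ
  · simp
  have hQ' : (0 : ℝ) < Q := by exact_mod_cast hQ
  refine Nat.cast_div_le.trans ?_
  rw [div_le_iff₀ (by linarith)]
  push_cast
  have h1 := half_cast_le y
  calc ((y / 2 : ℕ) : ℝ) * Q ≤ y / 2 * Q := by gcongr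
    _ = 5 / 8 * y * (4 / 5 * Q) := by ring
    _ ≤ _ := by gcongr

theorem sweep_le {g : Finset (Fin n) → Fin n → ℕ} {Q : ℕ} {v : Fin n}
    (hg : LowerBound G g Q v) (l : List (Fin n × Fin m)) (hl : ∀ p ∈ l, p.1 ∈ G.nbrs v)
    {S : Finset (Fin n)} (hv : v ∉ S) (y : ℕ) :
    (sweep g Q v l S y : ℝ) ≤ (5 / 8) ^ l.length * y := by
  induction l generalizing S y with
  | nil => simp [sweep]
  | cons p l ih =>
    have hl' : ∀ p ∈ l, p.1 ∈ G.nbrs v := fun p hp => hl p (List.mem_cons_of_mem _ hp)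
    rw [sweep, List.length_cons, pow_succ, mul_assoc]
    split_ifs with h1 h2
    · rw [sweep_zero]; simp; positivity
    · have hx := hg (S.erase p.1) p.1 (hl p List.mem_cons_self) (by simp) (by simp [hv])
      refine (ih hl' (by simp [hv]) _).trans ?_
      gcongr
      exact cast_div_child_le hx
    · refine (ih hl' hv _).trans ?_
      gcongr
      have := half_cast_le y
      have : (0 : ℝ) ≤ y := by positivity
      linarith

/-- The entry `w` is only halved, and 1/2 = (4/5) · (5/8). -/
theorem sweep_le_of_notMem {g : Finset (Fin n) → Fin n → ℕ} {Q : ℕ} {v : Fin n}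
    (hg : LowerBound G g Q v) (l : List (Fin n × Fin m)) (hl : ∀ p ∈ l, p.1 ∈ G.nbrs v)
    {S : Finset (Fin n)} (hv : v ∉ S) {w : Fin n} (hw : ∃ p ∈ l, p.1 = w) (hwS : w ∉ S) (y : ℕ) :
    (sweep g Q v l S y : ℝ) ≤ 4 / 5 * ((5 / 8) ^ l.length * y) := by
  induction l generalizing S y with
  | nil => simp at hw
  | cons p l ih =>
    have hl' : ∀ p ∈ l, p.1 ∈ G.nbrs v := fun p hp => hl p (List.mem_cons_of_mem _ hp)
    have hy : (0 : ℝ) ≤ y := by positivity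
    rw [List.length_cons, pow_succ]
    by_cases hpw : p.1 = w
    · rw [sweep]
      split_ifs with h1 h2
      · rw [sweep_zero]; simp; positivity
      · exact absurd (hpw ▸ h2) hwS
      · refine (sweep_le hg l hl' hv _).trans ?_
        have := half_cast_le y
        calc (5 / 8 : ℝ) ^ l.length * ((y / 2 : ℕ) : ℝ) ≤ (5 / 8 : ℝ) ^ l.length * (y / 2) := by
              gcongr
          _ = _ := by ring
    · have hw' : ∃ p ∈ l, p.1 = w := by
        obtain ⟨p', hp', h⟩ := hw
        rcases List.mem_cons.1 hp' with rfl | hp'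
        · exact absurd h hpw
        · exact ⟨p', hp', h⟩
      rw [sweep, mul_assoc]
      split_ifs with h1 h2
      · rw [sweep_zero]; simp; positivity
      · have hx := hg (S.erase p.1) p.1 (hl p List.mem_cons_self) (by simp) (by simp [hv])
        refine (ih hl' (by simp [hv]) hw' (by simp [hwS]) _).trans ?_
        gcongr
        exact cast_div_child_le hx
      · refine (ih hl' hv hw' hwS _).trans ?_
        gcongr
        have := half_cast_le y
        linarith

/-- The computed values obey the same 4/5 bound as the true ratios, by the same argument: truncation
only lowers the sweep and so raises its complement. This keeps the divisors away from zero at every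
level. -/
theorem LowerBound.approx (hdeg : ∀ v, 3 ≤ G.degree v) (L : G.AdjList) (Q k : ℕ) (v : Fin n) :
    LowerBound G (approx L.list Q k) Q v := by
  induction k using Nat.strong_induction_on generalizing v with
  | _ k ih =>
  intro S u hu huS hvS
  have hQ : (0 : ℝ) ≤ Q := by positivity
  have hd := hdeg u
  rw [MultiGraph.approx, L.length_list]
  split_ifs with h
  · linarith
  · have h1 := sweep_le_of_notMem (ih (k + 2 - G.degree u) (by omega) u) (L.list u)
      (fun p hp => L.exists_mem_list.1 ⟨p, hp, rfl⟩) huS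
      (L.exists_mem_list.2 (G.mem_nbrs_comm.1 hu)) hvS Q
    rw [L.length_list] at h1
    have h2 : (5 / 8 : ℝ) ^ G.degree u ≤ (5 / 8) ^ 3 :=
      pow_le_pow_of_le_one (by norm_num) (by norm_num) hd
    have h3 : (5 / 8 : ℝ) ^ G.degree u * Q ≤ 1 / 4 * Q := by
      gcongr
      exact h2.trans (by norm_num)
    have h4 := sub_le_cast_sub Q
      (sweep (MultiGraph.approx L.list Q (k + 2 - G.degree u)) Q u (L.list u) S Q)
    linarith

theorem three_quarters_le_approx (hdeg : ∀ v, 3 ≤ G.degree v) (L : G.AdjList) (Q k : ℕ)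
    {S : Finset (Fin n)} {v : Fin n} (hv : v ∉ S) :
    (3 / 4 : ℝ) * Q ≤ approx L.list Q k S v := by
  have hQ : (0 : ℝ) ≤ Q := by positivity
  rw [approx, L.length_list]
  split_ifs with h
  · linarith
  · have h1 := sweep_le (LowerBound.approx hdeg L Q (k + 2 - G.degree v) v) (L.list v)
      (fun p hp => L.exists_mem_list.1 ⟨p, hp, rfl⟩) hv Q
    rw [L.length_list] at h1
    have h2 : (5 / 8 : ℝ) ^ G.degree v ≤ (5 / 8) ^ 3 :=
      pow_le_pow_of_le_one (by norm_num) (by norm_num) (hdeg v)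
    have h3 : (5 / 8 : ℝ) ^ G.degree v * Q ≤ 1 / 4 * Q := by
      gcongr
      exact h2.trans (by norm_num)
    have h4 := sub_le_cast_sub Q
      (sweep (MultiGraph.approx L.list Q (k + 2 - G.degree v)) Q v (L.list v) S Q)
    linarith

/-! ### Propagation of errors -/

theorem avoid_erase_le (hdeg : ∀ v, 3 ≤ G.degree v) {S : Finset (Fin n)} {u v : Fin n}
    (hu : u ∈ G.nbrs v) (hv : v ∉ S) : (G.avoid (S.erase u) : ℝ) ≤ 5 / 4 * G.avoid S := by
  by_cases huS : u ∈ S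
  · have h1 := G.avoid_insert_eq hdeg (S.erase u) u
    rw [Finset.insert_erase huS] at h1
    have h2 := G.four_fifths_le_ratio hdeg (S := S.erase u) (v := u) (w := v) (by simp)
      (G.mem_nbrs_comm.1 hu) (by simp [hv])
    have h3 := G.avoid_pos hdeg (S.erase u)
    nlinarith
  · rw [Finset.erase_eq_of_notMem huS]
    have h3 := G.avoid_pos hdeg S
    linarith

theorem avoid_sdiff_le (hdeg : ∀ v, 3 ≤ G.degree v) {v : Fin n} (l : List (Fin n × Fin m))
    (hl : ∀ p ∈ l, p.1 ∈ G.nbrs v) {S : Finset (Fin n)} (hv : v ∉ S) :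
    (G.avoid (S \ (l.map Prod.fst).toFinset) : ℝ) ≤ (5 / 4) ^ l.length * G.avoid S := by
  induction l generalizing S with
  | nil => simp
  | cons p l ih =>
    have h1 := avoid_erase_le hdeg (S := S) (hl p List.mem_cons_self) hv
    have h2 := ih (fun p hp => hl p (List.mem_cons_of_mem _ hp)) (S := S.erase p.1) (by simp [hv])
    have h3 : S \ ((p :: l).map Prod.fst).toFinset = S.erase p.1 \ (l.map Prod.fst).toFinset := by
      ext x; simp; tauto
    rw [h3, List.length_cons, pow_succ, mul_assoc]
    exact h2.trans (by gcongr)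

/-- The effect of one division step on the error. -/
theorem abs_div_step_le {y x r Y η : ℝ} (hx : 4 / 5 ≤ x) (hr : 4 / 5 ≤ r) (hY : 0 ≤ Y)
    (hxr : |x - r| ≤ η) :
    |y / 2 / x - Y / 2 / r| ≤ 5 / 8 * (|y - Y| + 5 / 4 * Y * η) := by
  have hx0 : 0 < x := by linarith
  have hr0 : 0 < r := by linarith
  have h1 : y / 2 / x - Y / 2 / r = 1 / (2 * x) * ((y - Y) - Y / r * (x - r)) := by
    field_simp
    ring
  have h2 : 1 / (2 * x) ≤ 5 / 8 := by
    rw [div_le_iff₀ (by linarith)]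
    linarith
  have h3 : Y / r ≤ 5 / 4 * Y := by
    rw [div_le_iff₀ hr0]
    nlinarith
  rw [h1, abs_mul, abs_of_nonneg (by positivity)]
  have h4 : |y - Y - Y / r * (x - r)| ≤ |y - Y| + 5 / 4 * Y * η := by
    refine (abs_sub _ _).trans ?_
    rw [abs_mul, abs_of_nonneg (by positivity : 0 ≤ Y / r)]
    gcongr
  gcongr

/-- Let Y = w · avoid(S) be the exact value approximated by y/Q. One entry turns an error e into at
most (5/8)(e + (5/4)Yη) + (13/8)/Q, and Y into at most (5/8)Y. As 13/3 is the fixed point of c ↦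
(5/8)c + 13/8, the excess over (13/3)/Q contracts. The free weight `w` absorbs the halvings; the
application starts with w = 1/avoid(S). -/
theorem abs_sweep_sub_le (hdeg : ∀ v, 3 ≤ G.degree v) {g : Finset (Fin n) → Fin n → ℕ} {Q : ℕ}
    (hQ : 0 < Q) {v : Fin n} {η : ℝ} (hη : 0 ≤ η) (hg : LowerBound G g Q v)
    (herr : ∀ S, ∀ u ∉ S, |(g S u : ℝ) / Q - G.ratio S u| ≤ η) {w : ℝ} (hw : 0 ≤ w)
    (l : List (Fin n × Fin m)) (hl : ∀ p ∈ l, p.1 ∈ G.nbrs v ∧ p.1 ≠ v)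
    {S : Finset (Fin n)} (hv : v ∉ S) (y : ℕ) :
    |(sweep g Q v l S y : ℝ) / Q -
        w * G.avoid (S \ (l.map Prod.fst).toFinset) / 2 ^ l.length| ≤
      (5 / 8) ^ l.length *
        (|(y : ℝ) / Q - w * G.avoid S| - 13 / 3 / Q + l.length * (5 / 4 * (w * G.avoid S) * η)) +
      13 / 3 / Q := by
  have hQ' : (0 : ℝ) < Q := by exact_mod_cast hQ
  induction l generalizing S y w with
  | nil => simp [sweep]
  | cons p l ih =>
    have hl' : ∀ p ∈ l, p.1 ∈ G.nbrs v ∧ p.1 ≠ v := fun p hp => hl p (List.mem_cons_of_mem _ hp)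
    obtain ⟨hpn, hpv⟩ := hl p List.mem_cons_self
    have hset : S \ ((p :: l).map Prod.fst).toFinset =
        S.erase p.1 \ (l.map Prod.fst).toFinset := by
      ext x; simp; tauto
    set Y := w * G.avoid S with hY
    have hY0 : 0 ≤ Y := by positivity
    have hvS' : v ∉ S.erase p.1 := by simp [hv]
    have hy1 := half_cast_le y
    have hy2 : (y : ℝ) / 2 - 1 / 2 ≤ ((y / 2 : ℕ) : ℝ) := by
      have : y ≤ 2 * (y / 2) + 1 := by omega
      have : (y : ℝ) ≤ 2 * ((y / 2 : ℕ) : ℝ) + 1 := by exact_mod_cast this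
      linarith
    -- it suffices to control a single step
    have hstep : ∀ y' : ℕ, sweep g Q v (p :: l) S y = sweep g Q v l (S.erase p.1) y' →
        |(y' : ℝ) / Q - w / 2 * G.avoid (S.erase p.1)| ≤
          5 / 8 * (|(y : ℝ) / Q - Y| + 5 / 4 * Y * η) + 13 / 8 / Q →
        |(sweep g Q v (p :: l) S y : ℝ) / Q -
            w * G.avoid (S \ ((p :: l).map Prod.fst).toFinset) / 2 ^ (p :: l).length| ≤
          (5 / 8) ^ (p :: l).length *
            (|(y : ℝ) / Q - Y| - 13 / 3 / Q + (p :: l).length * (5 / 4 * Y * η)) +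
          13 / 3 / Q := by
      intro y' hy' he
      have h1 := ih (w := w / 2) (by positivity) hl' hvS' y'
      rw [hset, hy', List.length_cons, pow_succ (2 : ℝ), mul_comm (2 ^ l.length : ℝ),
        ← div_div, mul_div_right_comm w]
      refine h1.trans ?_
      rw [pow_succ, mul_assoc ((5 / 8 : ℝ) ^ l.length)]
      refine add_le_add (mul_le_mul_of_nonneg_left ?_ (by positivity)) le_rfl
      have h2 : w / 2 * G.avoid (S.erase p.1) ≤ 5 / 8 * Y := by
        have := avoid_erase_le hdeg (S := S) hpn hv
        have := mul_le_mul_of_nonneg_left this hw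
        rw [hY]
        linarith
      have h3 : (l.length : ℝ) * (5 / 4 * (w / 2 * G.avoid (S.erase p.1)) * η) ≤
          l.length * (5 / 4 * (5 / 8 * Y) * η) := by gcongr
      have h4 : (13 / 8 / Q : ℝ) - 13 / 3 / Q = 5 / 8 * (-(13 / 3 / Q)) := by ring
      push_cast
      linarith
    by_cases hpS : p.1 ∈ S
    · refine hstep (y / 2 * Q / g (S.erase p.1) p.1) (by simp [sweep, hpv, hpS]) ?_
      set x := g (S.erase p.1) p.1 with hx
      set r := G.ratio (S.erase p.1) p.1 with hr
      have hxl : (4 / 5 : ℝ) * Q ≤ x := hg _ p.1 hpn (by simp) hvS'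
      have hrl : 4 / 5 ≤ r := G.four_fifths_le_ratio hdeg (by simp) (G.mem_nbrs_comm.1 hpn) hvS'
      have hxr : |(x : ℝ) / Q - r| ≤ η := herr _ _ (by simp)
      have hxl' : 4 / 5 ≤ (x : ℝ) / Q := by rwa [le_div_iff₀ hQ']
      have hx0 : (0 : ℝ) < x := by linarith
      have hideal : w / 2 * G.avoid (S.erase p.1) = Y / 2 / r := by
        have h1 := G.avoid_insert_eq hdeg (S.erase p.1) p.1
        rw [Finset.insert_erase hpS] at h1
        rw [hY, h1, ← hr]
        field_simp
      have hmain := abs_div_step_le (y := (y : ℝ) / Q) hxl' hrl hY0 hxr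
      have heq : (y : ℝ) / Q / 2 / (x / Q) = (y : ℝ) / 2 / x := by field_simp
      rw [heq] at hmain
      rw [hideal]
      have hup : ((y / 2 * Q / x : ℕ) : ℝ) / Q ≤ (y : ℝ) / 2 / x := by
        rw [div_le_iff₀ hQ']
        refine Nat.cast_div_le.trans ?_
        push_cast
        rw [div_mul_eq_mul_div]
        gcongr
      -- Halving loses at most 1/2, magnified by Q/x ≤ 5/4, and the quotient loses at most 1:
      -- together 5/8 + 1 = 13/8.
      have hlo : (y : ℝ) / 2 / x - 13 / 8 / Q ≤ ((y / 2 * Q / x : ℕ) : ℝ) / Q := by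
        rw [le_div_iff₀ hQ', sub_mul, div_mul_cancel₀ _ hQ'.ne']
        refine le_trans ?_ (sub_one_le_cast_div _ _)
        push_cast
        have h1 : ((y : ℝ) / 2 - 1 / 2) * Q / x ≤ ((y / 2 : ℕ) : ℝ) * Q / x := by gcongr
        have h2 : (Q : ℝ) / x ≤ 5 / 4 := by
          rw [div_le_iff₀ hx0]
          linarith
        have h3 : ((y : ℝ) / 2 - 1 / 2) * Q / x = (y : ℝ) / 2 / x * Q - 1 / 2 * (Q / x) := by ring
        linarith
      rw [abs_le] at hmain ⊢
      have : (0 : ℝ) ≤ 13 / 8 / Q := by positivity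
      constructor <;> linarith [hmain.1, hmain.2]
    · refine hstep (y / 2) (by simp [sweep, hpv, hpS]) ?_
      rw [Finset.erase_eq_of_notMem hpS]
      have hup : ((y / 2 : ℕ) : ℝ) / Q ≤ (y : ℝ) / Q / 2 := by
        rw [div_right_comm]
        gcongr
      have hlo : (y : ℝ) / Q / 2 - 1 / 2 / Q ≤ ((y / 2 : ℕ) : ℝ) / Q := by
        rw [div_right_comm, ← sub_div]
        gcongr
      have h1 : (13 / 8 / Q : ℝ) - 1 / 2 / Q = 9 / 8 / Q := by ring
      have h2 : (0 : ℝ) ≤ 9 / 8 / Q := by positivity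
      have h3 : 0 ≤ 5 / 4 * Y * η := by positivity
      have h4 := abs_nonneg ((y : ℝ) / Q - Y)
      have h5 := le_abs_self ((y : ℝ) / Q - Y)
      have h6 := neg_abs_le ((y : ℝ) / Q - Y)
      have h7 : w / 2 * G.avoid S = Y / 2 := by rw [hY]; ring
      have h8 : (0 : ℝ) ≤ 1 / 2 / Q := by positivity
      rw [h7, abs_le]
      constructor <;> linarith

/-- This fixes 15/16: the left side is 1875/2048 < 15/16 at d = 3, and raising d by one multiplies
it by (5/8)(d+1)/d ≤ 5/6. -/
theorem weight_le_pow {d : ℕ} (hd : 3 ≤ d) :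
    (5 / 8 : ℝ) ^ d * (d * (5 / 4)) ≤ (15 / 16) ^ (d - 2) := by
  induction d, hd using Nat.le_induction with
  | base => norm_num
  | succ d hd ih =>
    obtain ⟨c, rfl⟩ : ∃ c, d = c + 3 := ⟨d - 3, by omega⟩
    rw [show c + 3 + 1 - 2 = (c + 3 - 2) + 1 by omega, pow_succ _ (c + 3), pow_succ _ (c + 3 - 2)]
    have h1 : (0 : ℝ) ≤ (5 / 8) ^ (c + 3) := by positivity
    have h2 : (0 : ℝ) ≤ c := by positivity
    have h3 := mul_nonneg h1 h2
    generalize (5 / 8 : ℝ) ^ (c + 3) = t at *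
    push_cast at ih ⊢
    nlinarith

/-- The uniform contraction factor, used for the rounding error, which does not shrink with the
budget. -/
theorem weight_le {d : ℕ} (hd : 3 ≤ d) : (5 / 8 : ℝ) ^ d * (d * (5 / 4)) ≤ 1875 / 2048 := by
  induction d, hd using Nat.le_induction with
  | base => norm_num
  | succ d hd ih =>
    refine le_trans ?_ ih
    have h1 : (0 : ℝ) ≤ (5 / 8) ^ d := by positivity
    have h2 : (3 : ℝ) ≤ d := by exact_mod_cast hd
    rw [pow_succ, mul_assoc]
    refine mul_le_mul_of_nonneg_left ?_ h1
    push_cast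
    linarith

theorem pow_five_eighths_le {d : ℕ} (hd : 3 ≤ d) : (5 / 8 : ℝ) ^ d ≤ (15 / 16) ^ (d - 2) := by
  refine le_trans ?_ (weight_le_pow hd)
  have h1 : (0 : ℝ) ≤ (5 / 8) ^ d := by positivity
  have h2 : (3 : ℝ) ≤ d := by exact_mod_cast hd
  nlinarith

/-- The constant 60 closes the induction because (1875/2048) · 60 + 13/3 ≤ 60. -/
theorem abs_approx_sub_ratio_le (hdeg : ∀ v, 3 ≤ G.degree v) (L : G.AdjList) {Q : ℕ} (hQ : 0 < Q)
    (k : ℕ) (S : Finset (Fin n)) (v : Fin n) (hv : v ∉ S) :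
    |(approx L.list Q k S v : ℝ) / Q - G.ratio S v| ≤ (15 / 16) ^ k + 60 / Q := by
  have hQ' : (0 : ℝ) < Q := by exact_mod_cast hQ
  induction k using Nat.strong_induction_on generalizing S v with
  | _ k ih =>
  have hd := hdeg v
  have hlist : (L.list v |>.map Prod.fst).toFinset = G.nbrs v := by
    ext u
    rw [← L.exists_mem_list]
    simp
  have hmem : ∀ p ∈ L.list v, p.1 ∈ G.nbrs v := fun p hp => L.exists_mem_list.1 ⟨p, hp, rfl⟩
  rw [approx, L.length_list]
  by_cases hloop : v ∈ G.nbrs v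
  · rw [G.ratio_of_loop hdeg hloop, sweep_of_loop _ _ _ _ (L.exists_mem_list.2 hloop)]
    simp only [tsub_zero, dite_eq_ite, ite_self]
    rw [div_self hQ'.ne', sub_self, abs_zero]
    positivity
  have hS := G.avoid_pos hdeg S
  rw [G.ratio_of_loopless hdeg hloop hv]
  split_ifs with h
  -- At the cut-off the true ratio is within (5/8)^d of 1, and d - 2 ≥ k.
  · have h1 := avoid_sdiff_le hdeg (L.list v) hmem hv
    rw [hlist, L.length_list, ← div_le_iff₀ hS] at h1
    have h2 : (G.avoid (S \ G.nbrs v) : ℝ) / G.avoid S / 2 ^ G.degree v ≤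
        (5 / 8) ^ G.degree v := by
      rw [div_le_iff₀ (by positivity), ← mul_pow]
      norm_num
      exact h1
    have h3 : (15 / 16 : ℝ) ^ (G.degree v - 2) ≤ (15 / 16) ^ k :=
      pow_le_pow_of_le_one (by norm_num) (by norm_num) (by omega)
    have h4 := pow_five_eighths_le hd
    rw [div_self hQ'.ne', sub_sub_cancel, abs_of_nonneg (by positivity)]
    have : (0 : ℝ) ≤ 60 / Q := by positivity
    linarith
  · have hlow := LowerBound.approx hdeg L Q (k + 2 - G.degree v) v
    have h1 := abs_sweep_sub_le hdeg hQ (η := (15 / 16) ^ (k + 2 - G.degree v) + 60 / Q)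
      (by positivity) hlow (fun S u hu => ih _ (by omega) S u hu) (w := (G.avoid S : ℝ)⁻¹)
      (by positivity) (L.list v)
      (fun p hp => ⟨hmem p hp, fun h' => hloop (h' ▸ hmem p hp)⟩) hv Q
    rw [hlist, L.length_list, inv_mul_cancel₀ hS.ne', div_self hQ'.ne', sub_self, abs_zero] at h1
    have h2 := sweep_le hlow (L.list v) hmem hv Q
    rw [L.length_list] at h2
    have h3 : (5 / 8 : ℝ) ^ G.degree v * Q ≤ 1 * Q := by
      gcongr
      exact pow_le_one₀ (by norm_num) (by norm_num)
    rw [one_mul] at h3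
    rw [Nat.cast_sub (by exact_mod_cast h2.trans h3), sub_div, div_self hQ'.ne', sub_sub_sub_cancel_left,
      abs_sub_comm]
    have h4 := weight_le hd
    have h5 := weight_le_pow hd
    have h6 : (15 / 16 : ℝ) ^ k =
        (15 / 16) ^ (G.degree v - 2) * (15 / 16) ^ (k + 2 - G.degree v) := by
      rw [← pow_add]
      congr 1
      omega
    have h7 : (G.avoid S : ℝ)⁻¹ * G.avoid (S \ G.nbrs v) / 2 ^ G.degree v =
        G.avoid (S \ G.nbrs v) / G.avoid S / 2 ^ G.degree v := by ring
    rw [h7] at h1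
    refine h1.trans ?_
    have h8 : (5 / 8 : ℝ) ^ G.degree v * (G.degree v * (5 / 4)) *
        (15 / 16) ^ (k + 2 - G.degree v) ≤ (15 / 16) ^ k := by
      rw [h6]
      gcongr
    have h9 : (5 / 8 : ℝ) ^ G.degree v * (G.degree v * (5 / 4)) * (60 / Q) ≤
        1875 / 2048 * (60 / Q) := by gcongr
    have h10 : (0 : ℝ) ≤ (5 / 8) ^ G.degree v * (13 / 3 / Q) := by positivity
    have h11 : (60 / Q : ℝ) = 60 * (1 / Q) := by ring
    have h12 : (13 / 3 / Q : ℝ) = 13 / 3 * (1 / Q) := by ring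
    have h13 : (0 : ℝ) ≤ 1 / Q := by positivity
    rw [h11] at h9 ⊢
    nlinarith

end MultiGraph

/-! ### Reasoning about programs of the random access machine -/

namespace RAM

/-- All words of the configuration are less than `B`. -/
def Fits (B : ℕ) (c : Config) : Prop := ∀ i, c.reg i < B ∧ c.mem i < B

/-- Started in `c` with words less than `B`, the program reaches within `T` steps a configuration
with the property `Post`, and all words stay less than `B` on the way. -/
def Ok (P : Program) (B : ℕ) (Post : Config → Prop) (T : ℕ) (c : Config) : Prop :=
  Fits B c → ∃ t ≤ T, Post ((step P)^[t] c) ∧ ∀ s ≤ t, Fits B ((step P)^[s] c)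

/-- The registers with contents `l`, the remaining ones being zero. -/
def regs (l : List ℕ) : ℕ → ℕ := fun i => l.getD i 0

variable {P : Program} {B T pc d x y k : ℕ} {Post : Config → Prop} {c : Config} {l : List ℕ}
  {μ : ℕ → ℕ}

theorem update_regs (h : d < l.length) (z : ℕ) :
    Function.update (regs l) d z = regs (l.set d z) := by
  funext i
  by_cases hi : i = d
  · subst hi
    simp [regs, h]
  · have hi' : d ≠ i := fun h => hi h.symm
    simp [regs, Function.update_of_ne hi, List.getD, hi']

theorem Ok.done (h : Post c) : Ok P B Post T c :=
  fun hc => ⟨0, Nat.zero_le _, h, fun s hs => by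
    obtain rfl : s = 0 := by omega
    exact hc⟩

theorem Ok.mono {T' : ℕ} (h : Ok P B Post T c) (hT : T ≤ T') : Ok P B Post T' c := fun hc => by
  obtain ⟨t, ht, h⟩ := h hc
  exact ⟨t, ht.trans hT, h⟩

theorem Ok.of_step (hf : Fits B c → Fits B (step P c)) (h : Ok P B Post T (step P c)) :
    Ok P B Post (T + 1) c := fun hc => by
  obtain ⟨t, ht, hp, hs⟩ := h (hf hc)
  refine ⟨t + 1, by omega, by simpa using hp, fun s hst => ?_⟩
  rcases s with _ | s
  · exact hc
  · simpa using hs s (by omega)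

/-- The rules below execute the program symbolically, each passing the goal on to the next
configuration. The index check is Boolean so that `rfl` settles it on concrete register lists. -/
theorem Ok.of_set {z : ℕ} (hd : Nat.ble (d + 1) l.length = true)
    (hs : step P ⟨pc, regs l, μ⟩ = Config.set ⟨pc, regs l, μ⟩ d z)
    (hz : Fits B ⟨pc, regs l, μ⟩ → z < B) (h : Ok P B Post T ⟨pc + 1, regs (l.set d z), μ⟩) :
    Ok P B Post (T + 1) ⟨pc, regs l, μ⟩ := by
  have he : step P ⟨pc, regs l, μ⟩ = ⟨pc + 1, regs (l.set d z), μ⟩ := by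
    rw [hs, Config.set, update_regs (Nat.le_of_ble_eq_true hd)]
  refine Ok.of_step (fun hc i => ⟨?_, ?_⟩) (by rwa [he])
  · rw [hs, Config.set]
    by_cases hi : i = d
    · subst hi
      simpa using hz hc
    · simpa [Function.update_of_ne hi] using (hc i).1
  · rw [hs]
    exact (hc i).2

theorem step_eq {i : Instr} (hi : P.getD pc .halt = i) {r : ℕ → ℕ} :
    step P ⟨pc, r, μ⟩ = i.exec ⟨pc, r, μ⟩ := by
  rw [step, current, hi]

theorem Ok.const (hi : P.getD pc .halt = .const d k) (hd : Nat.ble (d + 1) l.length = true)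
    (hz : k < B) (h : Ok P B Post T ⟨pc + 1, regs (l.set d k), μ⟩) :
    Ok P B Post (T + 1) ⟨pc, regs l, μ⟩ :=
  Ok.of_set hd (step_eq hi) (fun _ => hz) h

theorem Ok.add (hi : P.getD pc .halt = .add d x y) (hd : Nat.ble (d + 1) l.length = true)
    (hz : l.getD x 0 + l.getD y 0 < B)
    (h : Ok P B Post T ⟨pc + 1, regs (l.set d (l.getD x 0 + l.getD y 0)), μ⟩) :
    Ok P B Post (T + 1) ⟨pc, regs l, μ⟩ :=
  Ok.of_set hd (step_eq hi) (fun _ => hz) h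

/-- The program copies by adding register 21, which lies beyond the list and is always zero. Unlike
a general addition, this needs no size check. -/
theorem Ok.copy (hi : P.getD pc .halt = .add d x y) (hd : Nat.ble (d + 1) l.length = true)
    (hy : l.getD y 0 = 0) (h : Ok P B Post T ⟨pc + 1, regs (l.set d (l.getD x 0)), μ⟩) :
    Ok P B Post (T + 1) ⟨pc, regs l, μ⟩ :=
  Ok.of_set (z := l.getD x 0) hd
    (by
      rw [step_eq hi]
      change Config.set _ d (l.getD x 0 + l.getD y 0) = _
      rw [hy, Nat.add_zero])
    (fun hc => (hc x).1) h

theorem Ok.mul (hi : P.getD pc .halt = .mul d x y) (hd : Nat.ble (d + 1) l.length = true)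
    (hz : l.getD x 0 * l.getD y 0 < B)
    (h : Ok P B Post T ⟨pc + 1, regs (l.set d (l.getD x 0 * l.getD y 0)), μ⟩) :
    Ok P B Post (T + 1) ⟨pc, regs l, μ⟩ :=
  Ok.of_set hd (step_eq hi) (fun _ => hz) h

theorem Ok.sub (hi : P.getD pc .halt = .sub d x y) (hd : Nat.ble (d + 1) l.length = true)
    (h : Ok P B Post T ⟨pc + 1, regs (l.set d (l.getD x 0 - l.getD y 0)), μ⟩) :
    Ok P B Post (T + 1) ⟨pc, regs l, μ⟩ :=
  Ok.of_set hd (step_eq hi) (fun hc => (Nat.sub_le _ _).trans_lt (hc x).1) h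

theorem Ok.div (hi : P.getD pc .halt = .div d x y) (hd : Nat.ble (d + 1) l.length = true)
    (h : Ok P B Post T ⟨pc + 1, regs (l.set d (l.getD x 0 / l.getD y 0)), μ⟩) :
    Ok P B Post (T + 1) ⟨pc, regs l, μ⟩ :=
  Ok.of_set hd (step_eq hi) (fun hc => (Nat.div_le_self _ _).trans_lt (hc x).1) h

theorem Ok.load {z : ℕ} (hi : P.getD pc .halt = .load d x)
    (hd : Nat.ble (d + 1) l.length = true) (hz : μ (l.getD x 0) = z)
    (h : Ok P B Post T ⟨pc + 1, regs (l.set d z), μ⟩) :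
    Ok P B Post (T + 1) ⟨pc, regs l, μ⟩ :=
  Ok.of_set hd (by rw [step_eq hi, ← hz]; rfl) (fun hc => hz ▸ (hc _).2) h

theorem Ok.store (hi : P.getD pc .halt = .store x y)
    (h : Ok P B Post T ⟨pc + 1, regs l, Function.update μ (l.getD x 0) (l.getD y 0)⟩) :
    Ok P B Post (T + 1) ⟨pc, regs l, μ⟩ := by
  refine Ok.of_step (fun hc i => ?_) (by rwa [step_eq hi])
  rw [step_eq hi]
  refine ⟨(hc i).1, ?_⟩
  change Function.update μ (l.getD x 0) (l.getD y 0) i < B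
  by_cases hi : i = l.getD x 0
  · rw [hi, Function.update_self]
    exact (hc y).1
  · rw [Function.update_of_ne hi]
    exact (hc i).2

theorem Ok.jump {p : ℕ} (hi : P.getD pc .halt = .jump p) (h : Ok P B Post T ⟨p, regs l, μ⟩) :
    Ok P B Post (T + 1) ⟨pc, regs l, μ⟩ :=
  Ok.of_step (fun hc => by rw [step_eq hi]; exact hc) (by rwa [step_eq hi])

theorem Ok.jlt {p : ℕ} (hi : P.getD pc .halt = .jlt x y p) (hxy : l.getD x 0 < l.getD y 0)
    (h : Ok P B Post T ⟨p, regs l, μ⟩) : Ok P B Post (T + 1) ⟨pc, regs l, μ⟩ :=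
  Ok.of_step (fun hc => by rw [step_eq hi]; exact hc)
    (by rw [step_eq hi, Instr.exec, if_pos (by exact hxy)]; exact h)

theorem Ok.jge {p : ℕ} (hi : P.getD pc .halt = .jlt x y p) (hxy : l.getD y 0 ≤ l.getD x 0)
    (h : Ok P B Post T ⟨pc + 1, regs l, μ⟩) : Ok P B Post (T + 1) ⟨pc, regs l, μ⟩ :=
  Ok.of_step (fun hc => by rw [step_eq hi]; exact hc)
    (by rw [step_eq hi, Instr.exec, if_neg (by exact Nat.not_lt.2 hxy)]; exact h)

end RAM

/-! ### The program -/

namespace RAM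

open MultiGraph

/-- The program. Positions `0`–`26` read the input and compute the scale, `27`–`30` and `83`–`92`
are the loop over the vertices, `31`–`39` copy the current vertex set to a new stack frame, `40`–`80`
evaluate `MultiGraph.approx`, whose value is in register 20 at position `81`, and `93`–`105` resume
the calling frame. -/
def counter : Program :=
  [.load 3 21, .const 8 1, .load 1 8, .const 9 2, .load 18 9, .add 19 8 9, .load 19 19,
   .div 18 19 18, .add 18 18 8, .mul 18 18 3, .const 10 5, .add 10 10 3, .sub 5 10 8, .load 5 5,
   .add 11 5 21, .const 4 4096, .mul 18 18 4, .const 2 12, .const 6 44, .const 19 11,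
   .jlt 4 18 22, .jump 26, .add 4 4 4, .add 2 2 8, .add 6 6 19, .jump 20, .add 0 4 21,
   .jlt 7 3 29, .halt, .add 17 7 21, .add 13 6 21, .const 18 0, .jlt 18 3 34, .jump 40,
   .add 19 11 18, .load 12 19, .add 19 19 10, .store 19 12, .add 18 18 8, .jump 32,
   .add 11 11 10, .add 12 17 21, .const 18 4, .add 18 18 12, .load 15 18, .add 18 18 8,
   .load 16 18, .sub 18 16 15, .div 18 18 9, .add 13 13 9, .jlt 18 13 53, .add 20 4 21, .jump 81,
   .sub 13 13 18, .add 14 4 21, .jlt 15 16 58, .sub 20 4 14, .jump 81, .load 17 15, .add 15 15 9,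
   .jlt 17 12 64, .jlt 12 17 64, .const 14 0, .jump 55, .div 14 14 9, .add 18 11 17, .load 19 18,
   .jlt 21 19 69, .jump 55, .store 18 21, .add 18 11 3, .store 18 13, .add 18 18 8, .store 18 14,
   .add 18 18 8, .store 18 15, .add 18 18 8, .store 18 16, .add 18 18 8, .store 18 12, .jump 31,
   .sub 11 11 10, .jlt 5 11 93, .mul 0 0 20, .div 0 0 4, .jlt 0 4 87, .jump 89, .add 0 0 0,
   .add 2 2 8, .add 18 5 7, .store 18 8, .add 7 7 8, .jump 27, .add 18 11 3, .load 13 18,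
   .add 18 18 8, .load 14 18, .add 18 18 8, .load 15 18, .add 18 18 8, .load 16 18, .add 18 18 8,
   .load 12 18, .mul 14 14 4, .div 14 14 20, .jump 55]

/-- The contents of the registers that do not change during the evaluation of
`MultiGraph.approx`. -/
structure Env where
  M : ℕ
  m : ℕ
  F : ℕ
  n : ℕ
  Q : ℕ
  base : ℕ
  K : ℕ
  i : ℕ

/-- The contents of all registers in use. -/
abbrev Env.file (E : Env) (fp v k y ptr en u t s x : ℕ) : List ℕ :=
  [E.M, E.m, E.F, E.n, E.Q, E.base, E.K, E.i, 1, 2, E.n + 5, fp, v, k, y, ptr, en, u, t, s, x]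

variable {B : ℕ} {Post : Config → Prop}

theorem ok_copy_loop (E : Env) {T f k y ptr en u x : ℕ} {μ : ℕ → ℕ} (hf : f + 2 * (E.n + 5) < B)
    (h : ∀ μ' v t s, (∀ a < f + (E.n + 5), μ' a = μ a) →
      (∀ w < E.n, μ' (f + (E.n + 5) + w) = μ (f + w)) →
      Ok counter B Post T ⟨40, regs (E.file f v k y ptr en u t s x), μ'⟩) (r : ℕ) :
    ∀ j v s μ', j + r = E.n → (∀ a < f + (E.n + 5), μ' a = μ a) →
      (∀ w < j, μ' (f + (E.n + 5) + w) = μ (f + w)) →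
      Ok counter B Post (T + 7 * r + 2) ⟨32, regs (E.file f v k y ptr en u j s x), μ'⟩ := by
  induction r with
  | zero =>
    intro j v s μ' hj h1 h2
    refine .jge rfl (by simp; omega) (.jump rfl ?_)
    exact h _ _ _ _ h1 fun w hw => h2 w (by omega)
  | succ r ih =>
    intro j v s μ' hj h1 h2
    refine .jlt rfl (by simp; omega) (.add rfl rfl (by simp; omega) (.load rfl rfl rfl
      (.add rfl rfl (by simp; omega) (.store rfl (.add rfl rfl (by simp; omega) (.jump rfl ?_))))))
    refine ih (j + 1) _ _ _ (by omega) (fun a ha => ?_) fun w hw => ?_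
    · simp
      rw [Function.update_of_ne (by omega)]
      exact h1 a ha
    · simp
      by_cases hwj : w = j
      · subst hwj
        rw [show f + (E.n + 5) + w = f + w + (E.n + 5) by omega, Function.update_self]
        exact h1 _ (by omega)
      · rw [Function.update_of_ne (by omega)]
        exact h2 w (by omega)

end RAM

/-! ### Correctness, space and time of the recursive evaluation -/

namespace RAM

open MultiGraph

variable {B : ℕ} {Post : Config → Prop}

/-- The memory `inp` holds the adjacency list below the address `base`. -/
structure Holds {n m : ℕ} {G : MultiGraph n m} (L : G.AdjList) (base : ℕ) (inp : ℕ → ℕ) : Prop where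
  start : ∀ v : Fin n, inp (4 + v) + 2 * (L.list v).length = inp (4 + v + 1)
  entry : ∀ (v : Fin n) (j : ℕ) (hj : j < (L.list v).length),
    inp (inp (4 + v) + 2 * j) = (L.list v)[j].1
  le_base : ∀ v : Fin n, inp (4 + v + 1) ≤ base
  header : n + 5 ≤ base

/-- From position `42` on, the program evaluates `MultiGraph.approx`. -/
def Evaluates (B : ℕ) (Post : Config → Prop) (E : Env) {m : ℕ} {G : MultiGraph E.n m}
    (L : G.AdjList) (inp : ℕ → ℕ) (k : ℕ) : Prop :=
  ∀ (T f y ptr en u t s x : ℕ) (μ : ℕ → ℕ) (S : Finset (Fin E.n)) (v : Fin E.n),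
    v ∉ S → E.base < f → f + (k + 2) * (E.n + 5) < B → (∀ a < E.base, μ a = inp a) →
    (∀ w : Fin E.n, μ (f + w) = if w ∈ S then 1 else 0) →
    (∀ μ' v' k' y ptr en u t s, (∀ a < f, μ' a = μ a) →
      Ok counter B Post T
        ⟨81, regs (E.file f v' k' y ptr en u t s (approx L.list E.Q k S v)), μ'⟩) →
    Ok counter B Post (T + (7 * E.n + 60) * 4 ^ k)
      ⟨42, regs (E.file f v k y ptr en u t s x), μ⟩

/-- The caller may be the main loop, whose frame is at `E.base`; a new frame lies strictly above,
which is how the return code tells the two kinds of caller apart. Budgets drop with each nested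
call, so the space condition follows them down. -/
theorem Evaluates.call {E : Env} {m : ℕ} {G : MultiGraph E.n m} {L : G.AdjList} {inp : ℕ → ℕ}
    {k : ℕ} (hk : Evaluates B Post E L inp k) {T f v' y ptr en t s x : ℕ} {μ : ℕ → ℕ}
    {S : Finset (Fin E.n)} {u : Fin E.n} (hu : u ∉ S) (hf : E.base ≤ f)
    (hB : f + (k + 3) * (E.n + 5) < B) (hμ : ∀ a < E.base, μ a = inp a)
    (hS : ∀ w : Fin E.n, μ (f + w) = if w ∈ S then 1 else 0)
    (h : ∀ μ' v' k' y ptr en u' t s, (∀ a < f + (E.n + 5), μ' a = μ a) →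
      Ok counter B Post T ⟨81, regs (E.file (f + (E.n + 5)) v' k' y ptr en u' t s
        (approx L.list E.Q k S u)), μ'⟩) :
    Ok counter B Post (T + (7 * E.n + 60) * 4 ^ k + 2 + 7 * E.n + 2 + 1)
      ⟨31, regs (E.file f v' k y ptr en u t s x), μ⟩ := by
  have hB' : f + (E.n + 5) + (k + 2) * (E.n + 5) < B := by
    rw [show k + 3 = k + 2 + 1 from rfl, Nat.succ_mul] at hB
    omega
  have hle : 2 * (E.n + 5) ≤ (k + 2) * (E.n + 5) := Nat.mul_le_mul_right _ (by omega)
  refine .const rfl rfl (by omega) ?_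
  refine ok_copy_loop E (μ := μ) (by omega) ?_ E.n 0 _ _ _ (by omega) (fun _ _ => rfl)
    (fun w hw => absurd hw (by omega))
  intro μ' v t s h1 h2
  refine .add rfl rfl (by simp; omega) (.copy rfl rfl rfl ?_)
  refine hk _ (f + (E.n + 5)) _ _ _ _ _ _ _ _ S u hu (by omega) hB' (fun a ha => ?_) (fun w => ?_) ?_
  · rw [h1 a (by omega), hμ a ha]
  · rw [h2 w w.2, hS]
  · intro μ'' _ _ _ _ _ _ _ _ h3
    exact h _ _ _ _ _ _ _ _ _ fun a ha => by rw [h3 a ha, h1 a ha]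

/-- A frame has n + 5 words: the indicator of the current set, then k, y, the list position, the
list end and the vertex. -/
theorem ok_save (E : Env) {T f v k y ptr en u s x : ℕ} {μ : ℕ → ℕ} (hu : u < E.n)
    (hf : f + (E.n + 5) < B)
    (h : ∀ μ' t, (∀ a < f, μ' a = μ a) → (∀ w < E.n, w ≠ u → μ' (f + w) = μ (f + w)) →
      μ' (f + u) = 0 → μ' (f + E.n) = k → μ' (f + E.n + 1) = y → μ' (f + E.n + 1 + 1) = ptr →
      μ' (f + E.n + 1 + 1 + 1) = en → μ' (f + E.n + 1 + 1 + 1 + 1) = v →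
      Ok counter B Post T ⟨31, regs (E.file f v k y ptr en u t s x), μ'⟩) :
    Ok counter B Post (T + 12) ⟨69, regs (E.file f v k y ptr en u (f + u) s x), μ⟩ := by
  refine .store rfl (.add rfl rfl (by simp; omega) (.store rfl (.add rfl rfl (by simp; omega)
    (.store rfl (.add rfl rfl (by simp; omega) (.store rfl (.add rfl rfl (by simp; omega)
    (.store rfl (.add rfl rfl (by simp; omega) (.store rfl (.jump rfl ?_)))))))))))
  refine h (Function.update (Function.update (Function.update (Function.update (Function.update
    (Function.update μ (f + u) 0) (f + E.n) k) (f + E.n + 1) y) (f + E.n + 1 + 1) ptr)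
    (f + E.n + 1 + 1 + 1) en) (f + E.n + 1 + 1 + 1 + 1) v) _
    (fun a ha => ?_) (fun w hw hwu => ?_) ?_ ?_ ?_ ?_ ?_ ?_
  · iterate 6 rw [Function.update_of_ne (by omega)]
  · iterate 6 rw [Function.update_of_ne (by omega)]
  · iterate 5 rw [Function.update_of_ne (by omega)]
    rw [Function.update_self]
  · iterate 4 rw [Function.update_of_ne (by omega)]
    rw [Function.update_self]
  · iterate 3 rw [Function.update_of_ne (by omega)]
    rw [Function.update_self]
  · iterate 2 rw [Function.update_of_ne (by omega)]
    rw [Function.update_self]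
  · rw [Function.update_of_ne (by omega), Function.update_self]
  · rw [Function.update_self]

theorem ok_resume (E : Env) {T f v k y ptr en v' k' y' ptr' en' u t s x : ℕ} {μ : ℕ → ℕ}
    (hf : f + (E.n + 5) < B) (e₀ : μ (f + E.n) = k) (e₁ : μ (f + E.n + 1) = y)
    (e₂ : μ (f + E.n + 1 + 1) = ptr) (e₃ : μ (f + E.n + 1 + 1 + 1) = en)
    (e₄ : μ (f + E.n + 1 + 1 + 1 + 1) = v) (hy : y * E.Q < B)
    (h : ∀ t, Ok counter B Post T
      ⟨55, regs (E.file f v k (y * E.Q / x) ptr en u t s x), μ⟩) :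
    Ok counter B Post (T + 13) ⟨93, regs (E.file f v' k' y' ptr' en' u t s x), μ⟩ := by
  refine .add rfl rfl (by simp; omega) (.load rfl rfl e₀ (.add rfl rfl (by simp; omega)
    (.load rfl rfl e₁ ?_)))
  simp only [List.set_cons_succ, List.set_cons_zero, List.getD_cons_succ, List.getD_cons_zero]
  refine .add rfl rfl (by simp; omega) (.load rfl rfl e₂ (.add rfl rfl (by simp; omega)
    (.load rfl rfl e₃ ?_)))
  simp only [List.set_cons_succ, List.set_cons_zero, List.getD_cons_succ, List.getD_cons_zero]
  refine .add rfl rfl (by simp; omega) (.load rfl rfl e₄ (.mul rfl rfl hy (.div rfl rfl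
    (.jump rfl (h _)))))

/-- Invariant: the frame at `f` holds the current set, and sweeping the remaining entries from the
current `y` still produces the final value `z`. Frames below `f` stay untouched. -/
theorem Evaluates.loop {E : Env} {m : ℕ} {G : MultiGraph E.n m} (hdeg : ∀ v, 3 ≤ G.degree v)
    {L : G.AdjList} {inp : ℕ → ℕ} {k : ℕ} (hk : Evaluates B Post E L inp k)
    (hQ : E.Q * E.Q < B) {f : ℕ} (hf : E.base < f) (hB : f + (k + 3) * (E.n + 5) < B)
    {v : Fin E.n} {T : ℕ} {μ₀ : ℕ → ℕ} {z : ℕ}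
    (h : ∀ μ' v' k' y ptr en u t s, (∀ a < f, μ' a = μ₀ a) →
      Ok counter B Post T ⟨81, regs (E.file f v' k' y ptr en u t s z), μ'⟩)
    (l : List (Fin E.n × Fin m)) :
    ∀ (y ptr en u t s x : ℕ) (μ : ℕ → ℕ) (S : Finset (Fin E.n)),
      (∀ p ∈ l, p.1 ∈ G.nbrs v) → v ∉ S → y ≤ E.Q →
      (∀ (j : ℕ) (hj : j < l.length), inp (ptr + 2 * j) = l[j].1) →
      ptr + 2 * l.length = en → en ≤ E.base → (∀ a < E.base, μ a = inp a) →
      (∀ w : Fin E.n, μ (f + w) = if w ∈ S then 1 else 0) →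
      (∀ a < f, μ a = μ₀ a) → z = E.Q - sweep (approx L.list E.Q k) E.Q v l S y →
      Ok counter B Post (T + 3 + l.length * (7 * E.n + 60 + (7 * E.n + 60) * 4 ^ k))
        ⟨55, regs (E.file f v k y ptr en u t s x), μ⟩ := by
  have hle : 3 * (E.n + 5) ≤ (k + 3) * (E.n + 5) := Nat.mul_le_mul_right _ (by omega)
  induction l with
  | nil =>
    intro y ptr en u t s x μ S _ _ _ _ hen _ _ _ hμ₀ hz
    refine Ok.mono (T := T + 3) ?_ (by omega)
    refine .jge rfl (by simp at hen; simp; omega) (.sub rfl rfl (.jump rfl ?_))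
    subst hz
    exact h _ _ _ _ _ _ _ _ _ hμ₀
  | cons p l ih =>
    intro y ptr en u t s x μ S hl hv hy hptr hen hbase hμ hS hμ₀ hz
    have hp : μ ptr = p.1 := by
      rw [hμ _ (by simp at hen; omega)]
      exact hptr 0 (by simp)
    have hl' : ∀ q ∈ l, q.1 ∈ G.nbrs v := fun q hq => hl q (List.mem_cons_of_mem _ hq)
    have hptr' : ∀ (j : ℕ) (hj : j < l.length), inp (ptr + 2 + 2 * j) = l[j].1 := by
      intro j hj
      have := hptr (j + 1) (by simpa using hj)
      rw [← show ptr + 2 * (j + 1) = ptr + 2 + 2 * j by ring, this]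
      rfl
    have hen' : ptr + 2 + 2 * l.length = en := by simp at hen; omega
    rw [List.length_cons, Nat.succ_mul]
    rw [sweep] at hz
    generalize hC : 7 * E.n + 60 + (7 * E.n + 60) * 4 ^ k = C at *
    by_cases hpv : p.1 = v
    · rw [if_pos hpv] at hz
      refine Ok.mono (T := T + 3 + l.length * C + 7) ?_ (by omega)
      refine .jlt rfl (by simp; omega) (.load rfl rfl hp (.add rfl rfl (by simp; omega)
        (.jge rfl (by simp [hpv]) (.jge rfl (by simp [hpv]) (.const rfl rfl (by omega)
        (.jump rfl ?_))))))
      exact ih _ _ _ _ _ _ _ _ S hl' hv (Nat.zero_le _) hptr' hen' hbase hμ hS hμ₀ hz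
    · rw [if_neg hpv] at hz
      -- the entry is not a loop
      suffices hneq : Ok counter B Post (T + 3 + l.length * C + C - 5)
          ⟨64, regs (E.file f v k y (ptr + 2) en p.1 t s x), μ⟩ by
        refine Ok.mono (T := T + 3 + l.length * C + C - 5 + 5) ?_ (by omega)
        refine .jlt rfl (by simp; omega) (.load rfl rfl hp (.add rfl rfl (by simp; omega) ?_))
        -- The machine tests inequality by two strict comparisons.
        rcases lt_or_gt_of_ne hpv with hlt | hlt
        · exact .jlt rfl hlt (hneq.mono (by omega))
        · exact .jge rfl hlt.le (.jlt rfl hlt hneq)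
      by_cases hpS : p.1 ∈ S
      · rw [if_pos hpS] at hz
        have hx : (4 / 5 : ℝ) * E.Q ≤ approx L.list E.Q k (S.erase p.1) p.1 :=
          LowerBound.approx hdeg L E.Q k v _ _ (hl p List.mem_cons_self) (by simp) (by simp [hv])
        have hy2 : y / 2 ≤ E.Q := by omega
        -- Keeping `y` at most `Q` makes the products with `Q` fit into words; this uses the 4/5
        -- bound.
        have hy' : y / 2 * E.Q / approx L.list E.Q k (S.erase p.1) p.1 ≤ E.Q := by
          have h1 := cast_div_child_le (y := y) hx
          have h2 : (y : ℝ) ≤ E.Q := by exact_mod_cast hy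
          have h3 : (0 : ℝ) ≤ y := by positivity
          have : ((y / 2 * E.Q / approx L.list E.Q k (S.erase p.1) p.1 : ℕ) : ℝ) ≤ E.Q := by
            linarith
          exact_mod_cast this
        have hu := p.1.2
        refine Ok.mono (T := T + 3 + l.length * C + 13 + 2 + (7 * E.n + 60) * 4 ^ k + 2 + 7 * E.n
          + 2 + 1 + 12 + 4) ?_ (by omega)
        refine .div rfl rfl (.add rfl rfl (by simp; omega) (.load rfl rfl
          ((hS p.1).trans (if_pos hpS)) (.jlt rfl Nat.zero_lt_one ?_)))
        refine ok_save E (y := y / 2) hu (by omega) ?_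
        intro μ' t hlow hrest hzero e₀ e₁ e₂ e₃ e₄
        have hS' : ∀ w : Fin E.n, μ' (f + w) = if w ∈ S.erase p.1 then 1 else 0 := by
          intro w
          by_cases hwp : w = p.1
          · rw [hwp, hzero]
            simp
          · rw [hrest w w.2 fun h' => hwp (Fin.ext h'), hS]
            simp [hwp]
        refine hk.call (S := S.erase p.1) (u := p.1) (by simp) hf.le hB
          (fun a ha => by rw [hlow a (by omega), hμ a ha]) hS' ?_
        intro μ'' v' k' y' ptr' en' u' t' s' hμ''
        -- The popped frame is above the base, so control returns to the interrupted sweep.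
        refine .sub rfl rfl (.jlt rfl (by simp; omega) ?_)
        simp only [List.set_cons_succ, List.set_cons_zero, List.getD_cons_succ,
          List.getD_cons_zero, Nat.add_sub_cancel]
        refine ok_resume E (by omega) ((hμ'' _ (by omega)).trans e₀) ((hμ'' _ (by omega)).trans e₁)
          ((hμ'' _ (by omega)).trans e₂) ((hμ'' _ (by omega)).trans e₃)
          ((hμ'' _ (by omega)).trans e₄) (lt_of_le_of_lt (Nat.mul_le_mul_right _ hy2) hQ)
          fun t => ?_
        refine ih _ _ _ _ _ _ _ _ (S.erase p.1) hl' (by simp [hv]) hy' hptr' hen' hbase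
          (fun a ha => ?_) (fun w => ?_) (fun a ha => ?_) hz
        · rw [hμ'' _ (by omega), hlow a (by omega), hμ a ha]
        · have hw := w.2
          rw [hμ'' _ (by omega), hS']
        · rw [hμ'' _ (by omega), hlow a ha, hμ₀ a ha]
      · rw [if_neg hpS] at hz
        have hu := p.1.2
        refine Ok.mono (T := T + 3 + l.length * C + 5) ?_ (by omega)
        refine .div rfl rfl (.add rfl rfl (by simp; omega) (.load rfl rfl
          ((hS p.1).trans (if_neg hpS)) (.jge rfl (by simp) (.jump rfl ?_))))
        exact ih _ _ _ _ _ _ _ _ S hl' hv (by simp; omega) hptr' hen' hbase hμ hS hμ₀ hz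

/-- The time recurrence in units of 7n + 60: one for the call itself, and for each of the d entries
one plus a recursive call. -/
theorem one_add_mul_four_pow_le {d k : ℕ} (hd : 3 ≤ d) (hk : d < k + 2) :
    1 + d + d * 4 ^ (k + 2 - d) ≤ 4 ^ k := by
  obtain ⟨c, rfl⟩ : ∃ c, d = c + 3 := ⟨d - 3, by omega⟩
  obtain ⟨j, rfl⟩ : ∃ j, k = j + 1 + (c + 1) := ⟨k - c - 2, by omega⟩
  rw [show j + 1 + (c + 1) + 2 - (c + 3) = j + 1 by omega, pow_add 4 (j + 1)]
  have h1 : 5 * c + 16 ≤ 4 * 4 ^ (c + 1) := by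
    induction c with
    | zero => norm_num
    | succ c ih =>
      have := ih (by omega) (by omega)
      rw [pow_succ]
      omega
  have h2 : 4 ≤ 4 ^ (j + 1) := by
    rw [pow_succ]
    have := Nat.one_le_pow j 4 (by norm_num)
    omega
  generalize 4 ^ (j + 1) = p at *
  generalize 4 ^ (c + 1) = q at *
  nlinarith

theorem evaluates {E : Env} {m : ℕ} {G : MultiGraph E.n m} (hdeg : ∀ v, 3 ≤ G.degree v)
    {L : G.AdjList} {inp : ℕ → ℕ} (hinp : Holds L E.base inp) (hQ : E.Q * E.Q < B)
    (hbase : E.base < B) (k : ℕ) : Evaluates B Post E L inp k := by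
  induction k using Nat.strong_induction_on with
  | _ k ih =>
  intro T f y ptr en u t s x μ S v hv hf hB hμ hS h
  have hv2 := v.2
  have hhead := hinp.header
  have hstart := hinp.start v
  have hend := hinp.le_base v
  have hk : k + 2 ≤ (k + 2) * (E.n + 5) := Nat.le_mul_of_pos_right _ (by omega)
  have hd : 3 ≤ (L.list v).length := by rw [L.length_list]; exact hdeg v
  have hW : 7 * E.n + 60 ≤ (7 * E.n + 60) * 4 ^ k :=
    Nat.le_mul_of_pos_right _ (pow_pos (by norm_num) _)
  by_cases hcut : k + 2 ≤ (L.list v).length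
  · have happ : approx L.list E.Q k S v = E.Q := by rw [approx, dif_pos (Or.inl hcut)]
    rw [happ] at h
    -- The degree is the difference of two offsets, so the cut-off is decided without reading the
    -- list.
    refine Ok.mono (T := T + 11) ?_ (by omega)
    refine .const rfl rfl (by omega) (.add rfl rfl (by simp; omega) (.load rfl rfl
      (hμ _ (by simp; omega)) (.add rfl rfl (by simp; omega) (.load rfl rfl
      (hμ _ (by simp; omega)) (.sub rfl rfl (.div rfl rfl (.add rfl rfl (by simp; omega)
      (.jge rfl (by simp; omega) (.copy rfl rfl rfl (.jump rfl ?_))))))))))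
    exact h _ _ _ _ _ _ _ _ _ fun _ _ => rfl
  · have happ : approx L.list E.Q k S v =
        E.Q - sweep (approx L.list E.Q (k + 2 - (L.list v).length)) E.Q v (L.list v) S E.Q := by
      rw [approx, dif_neg (by omega)]
    have htime := Nat.mul_le_mul_left (7 * E.n + 60) (one_add_mul_four_pow_le (k := k) hd (by omega))
    have hdiv : (inp (4 + v + 1) - inp (4 + v)) / 2 = (L.list v).length := by omega
    have hB' : f + (k + 2 - (L.list v).length + 3) * (E.n + 5) < B := by
      have : (k + 2 - (L.list v).length + 3) * (E.n + 5) ≤ (k + 2) * (E.n + 5) :=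
        Nat.mul_le_mul_right _ (by omega)
      omega
    refine Ok.mono (T := T + 3 + (L.list v).length *
      (7 * E.n + 60 + (7 * E.n + 60) * 4 ^ (k + 2 - (L.list v).length)) + 11) ?_
      (by nlinarith)
    refine .const rfl rfl (by omega) (.add rfl rfl (by simp; omega) (.load rfl rfl
      (hμ _ (by simp; omega)) (.add rfl rfl (by simp; omega) (.load rfl rfl
      (hμ _ (by simp; omega)) (.sub rfl rfl (.div rfl rfl (.add rfl rfl (by simp; omega)
      (.jlt rfl (by simp; omega) (.sub rfl rfl (.copy rfl rfl rfl ?_))))))))))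
    simp only [List.set_cons_succ, List.set_cons_zero, List.getD_cons_succ,
      List.getD_cons_zero, hdiv]
    exact (ih _ (by omega)).loop hdeg hQ hf hB' h (L.list v) _ _ _ _ _ _ _ _ S
      (fun p hp => L.exists_mem_list.1 ⟨p, hp, rfl⟩) hv le_rfl (hinp.entry v) hstart hend hμ hS
      (fun _ _ => rfl) happ

end RAM

/-! ### The encoding of the input -/

namespace MultiGraph

variable {n m : ℕ} {G : MultiGraph n m} (L : G.AdjList)

/-- The initial memory. -/
def AdjList.memory (a b : ℕ) : ℕ → ℕ := fun i => (L.encode a b).getD i 0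

theorem AdjList.offset_succ (v : Fin n) :
    L.offset v + 2 * (L.list v).length = L.offset (v + 1) := by
  have h : (Finset.univ.filter fun u : Fin n => u.val < v.val + 1) =
      insert v (Finset.univ.filter fun u : Fin n => u.val < v.val) := by
    ext u
    simp only [Finset.mem_filter, Finset.mem_univ, true_and, Finset.mem_insert, Fin.ext_iff]
    omega
  rw [offset, offset, h, Finset.sum_insert (by simp)]
  ring

theorem AdjList.offset_mono {i j : ℕ} (h : i ≤ j) : L.offset i ≤ L.offset j := by
  unfold offset
  gcongr

/-- Handshake: there are 2m edge-ends, with two words each. -/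
theorem AdjList.offset_eq : L.offset n = n + 5 + 4 * m := by
  have h : ∑ v : Fin n, (G.endsAt v).card = 2 * m := by
    have := Finset.card_eq_sum_card_fiberwise (s := (Finset.univ : Finset (Fin m × Bool)))
      (t := (Finset.univ : Finset (Fin n))) (f := fun d => G.endpoint d.1 d.2) (by simp)
    simp only [Finset.card_univ, Fintype.card_prod, Fintype.card_fin, Fintype.card_bool] at this
    rw [mul_comm, this]
    rfl
  simp only [offset, L.length_list, degree, Fin.is_lt, Finset.filter_true, h]
  ring

theorem AdjList.length_entries (l : List (Fin n × Fin m)) :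
    (l.flatMap fun p => [p.1.val, p.2.val]).length = 2 * l.length := by
  induction l with
  | nil => rfl
  | cons p l ih =>
    simp only [List.flatMap_cons, List.length_append, ih, List.length_cons, List.length_nil]
    omega

theorem AdjList.getElem?_entries (l : List (Fin n × Fin m)) (j : ℕ) (hj : j < l.length) :
    (l.flatMap fun p => [p.1.val, p.2.val])[2 * j]? = some l[j].1.val := by
  induction l generalizing j with
  | nil => simp at hj
  | cons p l ih =>
    rcases j with _ | j
    · rfl
    · have := ih j (by simpa using hj)
      rw [List.flatMap_cons, List.getElem?_append_right (by simp)]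
      simpa [show 2 * (j + 1) - 2 = 2 * j by omega] using this

theorem AdjList.length_take (i : ℕ) :
    (((List.finRange n).take i).flatMap fun v =>
      (L.list v).flatMap fun p => [p.1.val, p.2.val]).length + (n + 5) = L.offset i := by
  induction i with
  | zero => simp [offset]
  | succ i ih =>
    by_cases hi : i < n
    · rw [List.take_add_one, List.getElem?_eq_getElem (by simpa using hi)]
      have := L.offset_succ ⟨i, hi⟩
      simp only [List.flatMap_append, List.length_append, Option.toList_some,
        List.flatMap_singleton, List.getElem_finRange, Fin.cast_mk, length_entries] at this ⊢
      omega
    · have h1 : L.offset (i + 1) = L.offset i := by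
        unfold offset
        congr 3
        ext v
        have := v.2
        simp
        omega
      rw [h1, ← ih, List.take_of_length_le (by simp; omega), List.take_of_length_le (by simp; omega)]

theorem AdjList.memory_header (a b : ℕ) :
    L.memory a b 0 = n ∧ L.memory a b 1 = m ∧ L.memory a b 2 = a ∧ L.memory a b 3 = b :=
  ⟨rfl, rfl, rfl, rfl⟩

theorem AdjList.memory_offset (a b : ℕ) {i : ℕ} (hi : i ≤ n) :
    L.memory a b (4 + i) = L.offset i := by
  unfold memory encode
  rw [List.append_assoc, List.getD_append_right _ _ _ _ (by simp),
    List.getD_append _ _ _ _ (by simp; omega)]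
  simp [List.getD, List.getElem?_map, List.getElem?_range (show i < n + 1 by omega)]

theorem AdjList.memory_entry (a b : ℕ) (v : Fin n) (j : ℕ) (hj : j < (L.list v).length) :
    L.memory a b (L.offset v + 2 * j) = (L.list v)[j].1 := by
  unfold memory encode
  have hlen := L.length_take v
  have hsplit : List.finRange n =
      (List.finRange n).take v ++ (v :: (List.finRange n).drop (v + 1)) := by
    conv_lhs => rw [← List.take_append_drop v (List.finRange n)]
    rw [List.drop_eq_getElem_cons (by simp)]
    simp
  rw [List.getD_append_right _ _ _ _ (by simp; omega)]
  conv_lhs => rw [hsplit]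
  rw [List.flatMap_append, List.getD_append_right _ _ _ _ (by simp at hlen ⊢; omega),
    List.flatMap_cons, List.getD_append _ _ _ _ (by rw [length_entries]; simp at hlen ⊢; omega)]
  rw [List.getD, show L.offset v + 2 * j - ([n, m, a, b] ++
      List.map L.offset (List.range (n + 1))).length - (List.flatMap
      (fun v => List.flatMap (fun p : Fin n × Fin m => [p.1.val, p.2.val]) (L.list v))
      (List.take v (List.finRange n))).length = 2 * j by simp at hlen ⊢; omega,
    getElem?_entries _ _ hj]
  rfl

/-- The bottom frame starts right after the input; being zero, it represents the empty set. -/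
theorem AdjList.memory_of_le (a b : ℕ) {i : ℕ} (hi : L.offset n ≤ i) : L.memory a b i = 0 := by
  have hlen := L.length_take n
  rw [List.take_of_length_le (by simp)] at hlen
  refine List.getD_eq_default _ _ ?_
  simp only [encode, List.length_append, List.length_map, List.length_range, List.length_cons,
    List.length_nil]
  omega

theorem AdjList.memory_lt {a b B : ℕ} (hn : n < B) (hm : m < B) (ha : a < B) (hb : b < B)
    (hB : L.offset n < B) (i : ℕ) : L.memory a b i < B := by
  have h : ∀ x ∈ L.encode a b, x < B := by
    intro x hx
    simp only [encode, List.mem_append, List.mem_cons, List.not_mem_nil, or_false, List.mem_map,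
      List.mem_range, List.mem_flatMap, List.mem_finRange, true_and] at hx
    rcases hx with ((rfl | rfl | rfl | rfl) | ⟨i, hi, rfl⟩) | ⟨v, p, _, rfl | rfl⟩
    · exact hn
    · exact hm
    · exact ha
    · exact hb
    · exact (L.offset_mono (by omega)).trans_lt hB
    · exact p.1.2.trans hn
    · exact p.2.2.trans hm
  unfold memory
  rw [List.getD]
  cases hx : (L.encode a b)[i]? with
  | none => simp; omega
  | some x => exact h x (List.mem_of_getElem? hx)

theorem AdjList.holds (a b : ℕ) : RAM.Holds L (L.offset n) (L.memory a b) where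
  start v := by
    rw [L.memory_offset a b v.2.le, add_assoc, L.memory_offset a b v.2, L.offset_succ]
  entry v j hj := by rw [L.memory_offset a b v.2.le, L.memory_entry a b v j hj]
  le_base v := by
    rw [add_assoc, L.memory_offset a b v.2]
    exact L.offset_mono v.2
  header := by
    rw [L.offset_eq]
    omega

end MultiGraph

/-! ### The loop over the vertices -/

namespace MultiGraph

variable {n m : ℕ} {G : MultiGraph n m}

/-- The vertices less than `j`. -/
def below (n j : ℕ) : Finset (Fin n) := Finset.univ.filter fun v => v.val < j

theorem mem_below {j : ℕ} {v : Fin n} : v ∈ below n j ↔ v.val < j := by simp [below]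

theorem insert_below {j : ℕ} (hj : j < n) : insert ⟨j, hj⟩ (below n j) = below n (j + 1) := by
  ext v
  simp only [Finset.mem_insert, mem_below, Fin.ext_iff]
  omega

/-- `M * 2 ^ m / 2 ^ F` approximates `G.avoid S` up to `j` relative errors `δ`, and `M` is
normalised with respect to the scale `Q`. -/
structure Accurate (G : MultiGraph n m) (Q : ℕ) (δ : ℝ) (j : ℕ) (S : Finset (Fin n)) (M F : ℕ) :
    Prop where
  le_mantissa : Q ≤ M
  mantissa_lt : M < 2 * Q
  lower : (1 - δ) ^ j * G.avoid S ≤ M * 2 ^ m / 2 ^ F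
  upper : (M * 2 ^ m / 2 ^ F : ℝ) ≤ (1 + δ) ^ j * G.avoid S

/-- One multiplication, with normalisation. -/
theorem Accurate.step (hdeg : ∀ v, 3 ≤ G.degree v) (L : G.AdjList) {Q k j M F : ℕ} {δ : ℝ}
    {S : Finset (Fin n)} {v : Fin n} (hQ : 8 ≤ Q) (hδ : δ ≤ 1)
    (hkδ : 4 / 3 * ((15 / 16) ^ k + 61 / Q) ≤ δ) (hv : v ∉ S) (h : Accurate G Q δ j S M F) :
    let M' := M * approx L.list Q k S v / Q
    (M' < Q → Accurate G Q δ (j + 1) (insert v S) (M' + M') (F + 1)) ∧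
      (Q ≤ M' → Accurate G Q δ (j + 1) (insert v S) M' F) := by
  intro M'
  obtain ⟨h1, h2, hlo, hup⟩ := h
  have hx := approx_le L.list Q k S v
  have hx34 := three_quarters_le_approx hdeg L Q k hv
  have herr := abs_approx_sub_ratio_le hdeg L (show 0 < Q by omega) k S v hv
  have hr := G.three_quarters_le_ratio hdeg hv
  have hQ' : (8 : ℝ) ≤ Q := by exact_mod_cast hQ
  have hM : (Q : ℝ) ≤ M := by exact_mod_cast h1
  have hins := G.avoid_insert_eq hdeg S v
  have hS := G.avoid_pos hdeg S
  set x := approx L.list Q k S v with hxdef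
  set r := G.ratio S v with hrdef
  have hM_le : M' ≤ M := by
    refine Nat.div_le_of_le_mul ?_
    rw [mul_comm]
    exact Nat.mul_le_mul_right _ hx
  have hup' : (M' : ℝ) ≤ M * (x / Q) := by
    refine Nat.cast_div_le.trans ?_
    push_cast
    rw [mul_div_assoc]
  have hlo' : (M : ℝ) * (x / Q) - 1 ≤ M' := by
    refine le_trans ?_ (sub_one_le_cast_div _ _)
    push_cast
    rw [mul_div_assoc]
  have hx34' : 3 / 4 ≤ (x : ℝ) / Q := by rwa [le_div_iff₀ (by linarith)]
  -- Since Q ≥ 8, this is at least Q/2, so one doubling renormalises the mantissa.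
  have hM_low : (3 / 4 : ℝ) * Q - 1 ≤ M' := by
    have : (3 / 4 : ℝ) * Q ≤ M * (x / Q) := by
      rw [mul_comm]
      exact mul_le_mul hM hx34' (by norm_num) (by linarith)
    linarith
  rw [abs_le] at herr
  set e : ℝ := (15 / 16) ^ k + 60 / Q with he
  have he61 : (15 / 16 : ℝ) ^ k + 61 / Q = e + 1 / Q := by rw [he]; ring
  rw [he61] at hkδ
  have h1Q : (0 : ℝ) ≤ 1 / Q := by positivity
  have he0 : 0 ≤ e := by positivity
  have hM0 : (0 : ℝ) ≤ M := by positivity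
  -- The quotient's truncation adds 1/Q to the 60/Q of the approximation. Dividing by r ≥ 3/4 makes
  -- the error relative, whence 61 and 4/3.
  have heδ : e + 1 / Q ≤ δ * r := by nlinarith
  have hMQ : 1 ≤ (M : ℝ) * (1 / Q) := by
    rw [mul_one_div, le_div_iff₀ (by linarith)]
    linarith
  have hδ0 : 0 ≤ δ := by linarith
  have hupM : (M' : ℝ) ≤ M * ((1 + δ) * r) := by
    refine hup'.trans (mul_le_mul_of_nonneg_left ?_ hM0)
    linarith [herr.2]
  have hloM : (M : ℝ) * ((1 - δ) * r) ≤ M' := by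
    have : (M : ℝ) * ((1 - δ) * r) ≤ M * (x / Q - 1 / Q) := by
      refine mul_le_mul_of_nonneg_left ?_ hM0
      linarith [herr.1]
    linarith
  have hfin : (1 - δ) ^ (j + 1) * G.avoid (insert v S) ≤ M' * 2 ^ m / 2 ^ F ∧
      (M' * 2 ^ m / 2 ^ F : ℝ) ≤ (1 + δ) ^ (j + 1) * G.avoid (insert v S) := by
    have hp : (0 : ℝ) ≤ 2 ^ m / 2 ^ F := by positivity
    rw [hins]
    constructor
    · calc (1 - δ) ^ (j + 1) * (r * G.avoid S)
          = ((1 - δ) * r) * ((1 - δ) ^ j * G.avoid S) := by ring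
        _ ≤ ((1 - δ) * r) * (M * 2 ^ m / 2 ^ F) :=
          mul_le_mul_of_nonneg_left hlo (mul_nonneg (by linarith) (by linarith))
        _ = M * ((1 - δ) * r) * (2 ^ m / 2 ^ F) := by ring
        _ ≤ M' * (2 ^ m / 2 ^ F) := mul_le_mul_of_nonneg_right hloM hp
        _ = _ := by ring
    · calc (M' * 2 ^ m / 2 ^ F : ℝ) = M' * (2 ^ m / 2 ^ F) := by ring
        _ ≤ M * ((1 + δ) * r) * (2 ^ m / 2 ^ F) := mul_le_mul_of_nonneg_right hupM hp
        _ = ((1 + δ) * r) * (M * 2 ^ m / 2 ^ F) := by ring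
        _ ≤ ((1 + δ) * r) * ((1 + δ) ^ j * G.avoid S) :=
          mul_le_mul_of_nonneg_left hup (mul_nonneg (by linarith) (by linarith))
        _ = _ := by ring
  refine ⟨fun hlt => ⟨?_, by omega, ?_, ?_⟩, fun hge => ⟨hge, by omega, hfin.1, hfin.2⟩⟩
  · have : (Q : ℝ) ≤ M' + M' := by linarith
    exact_mod_cast this
  · have : ((M' + M' : ℕ) : ℝ) * 2 ^ m / 2 ^ (F + 1) = M' * 2 ^ m / 2 ^ F := by
      push_cast
      rw [pow_succ]
      field_simp
      ring
    rw [this]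
    exact hfin.1
  · have : ((M' + M' : ℕ) : ℝ) * 2 ^ m / 2 ^ (F + 1) = M' * 2 ^ m / 2 ^ F := by
      push_cast
      rw [pow_succ]
      field_simp
      ring
    rw [this]
    exact hfin.2

end MultiGraph

namespace RAM

open MultiGraph

/-- The program has stopped with an accurate result. -/
def Success {n m : ℕ} (G : MultiGraph n m) (Q : ℕ) (δ : ℝ) (c : Config) : Prop :=
  Halted counter c ∧ c.reg 1 = m ∧ Accurate G Q δ n Finset.univ (c.reg 0) (c.reg 2)

/-- The bottom frame is the indicator of the vertices already treated, and `F` grows by at most one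
per vertex. The bound on δ is required only for n > 0 because the parameters degenerate for the
empty graph. -/
theorem ok_main_loop {B n m Q K F₀ : ℕ} {G : MultiGraph n m} {L : G.AdjList} {δ : ℝ}
    {inp : ℕ → ℕ} (hdeg : ∀ v, 3 ≤ G.degree v) {base : ℕ} (hinp : Holds L base inp)
    (hQ : 8 ≤ Q) (hδ : δ ≤ 1) (hKδ : 0 < n → 4 / 3 * ((15 / 16) ^ K + 61 / Q) ≤ δ)
    (hQB : 2 * Q * Q < B) (hB : base + (K + 3) * (n + 5) < B) (hF : F₀ + n < B) (r : ℕ) :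
    ∀ (j M F v k y ptr en u t s x : ℕ) (μ : ℕ → ℕ), j + r = n → F ≤ F₀ + j →
      Accurate G Q δ j (below n j) M F → (∀ a < base, μ a = inp a) →
      (∀ w < n, μ (base + w) = if w < j then 1 else 0) →
      Ok counter B (Success G Q δ) (r * ((7 * n + 60) * 4 ^ K + 7 * n + 30) + 1)
        ⟨27, regs (Env.file ⟨M, m, F, n, Q, base, K, j⟩ base v k y ptr en u t s x), μ⟩ := by
  have hle : 3 * (n + 5) ≤ (K + 3) * (n + 5) := Nat.mul_le_mul_right _ (by omega)
  have hQB' : Q * Q < B := by nlinarith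
  have hQ2 : 2 * Q ≤ 2 * Q * Q := Nat.le_mul_of_pos_right _ (by omega)
  induction r with
  | zero =>
    intro j M F v k y ptr en u t s x μ hj hF' hacc _ _
    refine Ok.mono (T := 0 + 1) ?_ (by omega)
    refine .jge rfl (by simp; omega) (.done ⟨rfl, rfl, ?_⟩)
    have h1 : below n j = Finset.univ := by
      ext w
      have := w.2
      simp [mem_below]
      omega
    rw [h1, show j = n by omega] at hacc
    exact hacc
  | succ r ih =>
    intro j M F v k y ptr en u t s x μ hj hF' hacc hμ hS
    have hjn : j < n := by omega
    have hstep := hacc.step hdeg L (k := K) (v := ⟨j, hjn⟩) hQ hδ (hKδ (by omega))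
      (by simp [mem_below])
    rw [insert_below] at hstep
    refine Ok.mono (T := r * ((7 * n + 60) * 4 ^ K + 7 * n + 30) + 1 + 11 +
      (7 * n + 60) * 4 ^ K + 2 + 7 * n + 2 + 1 + 3) ?_ (by rw [Nat.succ_mul r]; omega)
    refine .jlt rfl hjn (.copy rfl rfl rfl (.copy rfl rfl rfl ?_))
    refine Evaluates.call (E := ⟨M, m, F, n, Q, base, K, j⟩) (L := L) (S := below n j)
      (u := ⟨j, hjn⟩) (evaluates (E := ⟨M, m, F, n, Q, base, K, j⟩) hdeg hinp hQB' (by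
        simp only; omega) K) (by simp [mem_below]) le_rfl hB hμ (fun w => ?_) ?_
    · rw [hS w w.2]
      simp [mem_below]
    intro μ' v' k' y ptr en u' t s hμ'
    simp only at hμ'
    refine .sub rfl rfl ?_
    simp only [List.set_cons_succ, List.set_cons_zero, List.getD_cons_succ, List.getD_cons_zero,
      Nat.add_sub_cancel]
    have hx := approx_le L.list Q K (below n j) ⟨j, hjn⟩
    generalize approx L.list Q K (below n j) ⟨j, hjn⟩ = x at hstep hx ⊢
    have hMx : M * x < B := by
      have := Nat.mul_le_mul hacc.mantissa_lt.le hx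
      omega
    -- The stack pointer is back at the base, so the value belongs to the main loop.
    refine .jge rfl le_rfl (.mul rfl rfl hMx (.div rfl rfl ?_))
    simp only [List.set_cons_zero, List.getD_cons_succ, List.getD_cons_zero]
    have hnext : ∀ M' F', F' ≤ F₀ + (j + 1) → Accurate G Q δ (j + 1) (below n (j + 1)) M' F' →
        Ok counter B (Success G Q δ) (r * ((7 * n + 60) * 4 ^ K + 7 * n + 30) + 1 + 4)
          ⟨89, regs (Env.file ⟨M', m, F', n, Q, base, K, j⟩ base v' k' y ptr en u' t s x), μ'⟩ := by
      intro M' F' hF'' hacc'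
      refine .add rfl rfl (by simp; omega) (.store rfl (.add rfl rfl (by simp; omega)
        (.jump rfl ?_)))
      refine ih (j + 1) M' F' _ _ _ _ _ _ _ _ _ _ (by omega) hF'' hacc' (fun a ha => ?_)
        (fun w hw => ?_)
      · refine (Function.update_of_ne (by simp; omega) _ _).trans ?_
        rw [hμ' a (by omega), hμ a ha]
      · by_cases hwj : w = j
        · subst hwj
          refine (Function.update_self _ _ _).trans (by simp)
        · refine (Function.update_of_ne (by simp; omega) _ _).trans ?_
          rw [hμ' _ (by omega), hS w hw]
          congr 1
          apply propext
          omega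
    by_cases hlt : M * x / Q < Q
    · refine .jlt rfl hlt (.add rfl rfl ?_ (.add rfl rfl (by simp; omega) ?_))
      · simp only [List.getD_cons_zero]
        omega
      · exact (hnext _ _ (by omega) (hstep.1 hlt)).mono (by omega)
    · refine .jge rfl (not_lt.1 hlt) (.jump rfl ?_)
      exact (hnext _ _ (by omega) (hstep.2 (not_lt.1 hlt))).mono (by omega)

/-- The least power of two not below `N` is found by doubling the scale; each doubling adds 11 to
the budget, since (15/16)^11 < 1/2. -/
theorem ok_scale_loop {B n m N base T : ℕ} {Post : Config → Prop} {μ : ℕ → ℕ}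
    (hQB : 2 * (4096 * 2 ^ Nat.clog 2 N) < B) (hKB : 44 + 11 * Nat.clog 2 N < B)
    (h : ∀ t s, Ok counter B Post T ⟨26, regs (Env.file ⟨0, m, 12 + Nat.clog 2 N, n,
      4096 * 2 ^ Nat.clog 2 N, base, 44 + 11 * Nat.clog 2 N, 0⟩ base 0 0 0 0 0 0 t s 0), μ⟩)
    (r : ℕ) : ∀ J, J + r = Nat.clog 2 N →
      Ok counter B Post (T + 5 * r + 2) ⟨20, regs (Env.file ⟨0, m, 12 + J, n,
        4096 * 2 ^ J, base, 44 + 11 * J, 0⟩ base 0 0 0 0 0 0 (N * 4096) 11 0), μ⟩ := by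
  induction r with
  | zero =>
    intro J hJ
    obtain rfl : J = Nat.clog 2 N := by omega
    have := Nat.le_pow_clog one_lt_two N
    refine .jge rfl (by simp; omega) (.jump rfl ?_)
    exact h _ _
  | succ r ih =>
    intro J hJ
    have h1 : 2 ^ J < N := Nat.pow_lt_of_lt_clog (by omega)
    have h2 : 2 ^ J ≤ 2 ^ Nat.clog 2 N := Nat.pow_le_pow_right (by norm_num) (by omega)
    have h3 : 4096 * 2 ^ J + 4096 * 2 ^ J = 4096 * 2 ^ (J + 1) := by rw [pow_succ]; ring
    refine .jlt rfl (by simp; omega) (.add rfl rfl (by simp; omega) (.add rfl rfl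
      (by simp; omega) (.add rfl rfl (by simp; omega) (.jump rfl ?_))))
    simp only [List.set_cons_succ, List.set_cons_zero, List.getD_cons_succ, List.getD_cons_zero, h3]
    exact ih (J + 1) (by omega)

theorem ok_start {B n m a b T : ℕ} {G : MultiGraph n m} (L : G.AdjList) {Post : Config → Prop}
    (hQB : 2 * (4096 * 2 ^ Nat.clog 2 ((b / a + 1) * n)) < B)
    (hKB : 44 + 11 * Nat.clog 2 ((b / a + 1) * n) < B) (hb : b + 1 < B) (hn : n + 5 < B)
    (hN : (b / a + 1) * n * 4096 < B)
    (h : ∀ t s, Ok counter B Post T ⟨27, regs (Env.file ⟨4096 * 2 ^ Nat.clog 2 ((b / a + 1) * n), m,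
      12 + Nat.clog 2 ((b / a + 1) * n), n, 4096 * 2 ^ Nat.clog 2 ((b / a + 1) * n), L.offset n,
      44 + 11 * Nat.clog 2 ((b / a + 1) * n), 0⟩ (L.offset n) 0 0 0 0 0 0 t s 0), L.memory a b⟩) :
    Ok counter B Post (T + 1 + 5 * Nat.clog 2 ((b / a + 1) * n) + 2 + 20)
      (init (L.encode a b)) := by
  have h_init_eq : init (L.encode a b) = ⟨0, regs (List.replicate 21 0), L.memory a b⟩ := by
    have : regs (List.replicate 21 0) = fun _ => 0 := by
      funext i
      unfold regs
      rw [List.getD, List.getElem?_replicate]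
      split_ifs <;> rfl
    rw [this]
    rfl
  obtain ⟨h0, h1, h2, h3⟩ := L.memory_header a b
  have hoff : L.memory a b (5 + n - 1) = L.offset n := by
    rw [show 5 + n - 1 = 4 + n by omega, L.memory_offset a b le_rfl]
  have hdiv : b / a ≤ b := Nat.div_le_self b a
  have hpow := Nat.one_le_two_pow (n := Nat.clog 2 ((b / a + 1) * n))
  rw [h_init_eq]
  change Ok _ _ _ _ ⟨0, regs [0, 0, 0, 0, 0, 0, 0, 0, 0, 0, 0, 0, 0, 0, 0, 0, 0, 0, 0, 0, 0], _⟩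
  refine .load rfl rfl h0 (.const rfl rfl (by omega) (.load rfl rfl h1 (.const rfl rfl (by omega)
    (.load rfl rfl h2 ?_))))
  simp only [List.set_cons_succ, List.set_cons_zero]
  refine .add rfl rfl (by simp; omega) (.load rfl rfl h3 (.div rfl rfl (.add rfl rfl
    (by simp; omega) ?_)))
  simp only [List.set_cons_succ, List.set_cons_zero, List.getD_cons_succ, List.getD_cons_zero]
  refine .mul rfl rfl (by simp; omega) (.const rfl rfl (by omega) (.add rfl rfl (by simp; omega)
    (.sub rfl rfl (.load rfl rfl hoff (.copy rfl rfl rfl ?_)))))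
  simp only [List.set_cons_succ, List.set_cons_zero, List.getD_cons_succ, List.getD_cons_zero]
  refine .const rfl rfl (by omega) (.mul rfl rfl (by simp; omega) (.const rfl rfl (by omega)
    (.const rfl rfl (by omega) (.const rfl rfl (by omega) ?_))))
  simp only [List.set_cons_succ, List.set_cons_zero, List.getD_cons_succ, List.getD_cons_zero,
    Nat.add_comm 5 n]
  refine ok_scale_loop hQB hKB (fun t s => ?_) _ 0 (by omega)
  exact .copy rfl rfl rfl (h t s)

end RAM

/-! ### Accuracy, word size and running time -/

theorem two_pow_clog_le {N : ℕ} (hN : 0 < N) : 2 ^ Nat.clog 2 N ≤ 2 * N := by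
  rcases Nat.lt_or_ge 1 N with h | h
  · have h1 := Nat.pow_pred_clog_lt_self one_lt_two h
    have h2 := Nat.clog_pos one_lt_two h
    obtain ⟨c, hc⟩ : ∃ c, Nat.clog 2 N = c + 1 := ⟨Nat.clog 2 N - 1, by omega⟩
    rw [hc] at h1 ⊢
    rw [Nat.pred_succ] at h1
    rw [pow_succ]
    omega
  · rw [Nat.clog_of_right_le_one h]
    omega

/-- The starting values 44 and 4096 give (15/16)^44 ≤ 1/16 and 61/4096 < 1/16, so the left side is
at most (4/3)(1/8)/N. -/
theorem per_vertex_error_le {N : ℕ} (hN : 0 < N) :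
    4 / 3 * ((15 / 16 : ℝ) ^ (44 + 11 * Nat.clog 2 N) + 61 / (4096 * 2 ^ Nat.clog 2 N : ℕ)) ≤
      1 / (2 * N) := by
  have hN' : (0 : ℝ) < N := by exact_mod_cast hN
  have h1 : (N : ℝ) ≤ 2 ^ Nat.clog 2 N := by exact_mod_cast Nat.le_pow_clog one_lt_two N
  have h2 : (1 : ℝ) / 2 ^ Nat.clog 2 N ≤ 1 / N := by gcongr
  have h3 : (15 / 16 : ℝ) ^ (44 + 11 * Nat.clog 2 N) ≤ 1 / 16 * (1 / 2 ^ Nat.clog 2 N) := by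
    rw [pow_add, pow_mul]
    have h4 : (15 / 16 : ℝ) ^ 44 ≤ 1 / 16 := by norm_num
    have h5 : ((15 / 16 : ℝ) ^ 11) ^ Nat.clog 2 N ≤ (1 / 2) ^ Nat.clog 2 N := by
      gcongr
      norm_num
    rw [one_div_pow] at h5
    exact mul_le_mul h4 h5 (by positivity) (by norm_num)
  have h6 : (61 : ℝ) / (4096 * 2 ^ Nat.clog 2 N : ℕ) = 61 / 4096 * (1 / 2 ^ Nat.clog 2 N) := by
    push_cast
    field_simp
  have h7 : (1 : ℝ) / (2 * N) = 1 / 2 * (1 / N) := by field_simp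
  have h8 : (0 : ℝ) ≤ 1 / N := by positivity
  rw [h6, h7]
  linarith

/-- The quantities in the algorithm fit into words. -/
theorem word_bounds {n m a b X N : ℕ} (hX : X = n + m + a + b) (ha : 0 < a) (hab : a < b)
    (hN : N = (b / a + 1) * n) :
    2 * (4096 * 2 ^ Nat.clog 2 N) * (4096 * 2 ^ Nat.clog 2 N) < X ^ 30 ∧
      n + 5 + 4 * m + (44 + 11 * Nat.clog 2 N + 3) * (n + 5) < X ^ 30 ∧
      12 + Nat.clog 2 N + n < X ^ 30 ∧ N * 4096 < X ^ 30 ∧ X + 5 < X ^ 30 := by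
  have hX3 : 3 ≤ X := by omega
  have hdiv : b / a ≤ b := Nat.div_le_self b a
  have hNX : N ≤ X ^ 2 := by
    rw [hN, sq]
    exact Nat.mul_le_mul (by omega) (by omega)
  have hp : ∀ k, 1 ≤ X ^ k := fun k => Nat.one_le_pow _ _ (by omega)
  -- Because X ≥ 3, every factor 3 in a constant is paid for by one more power of X; for instance
  -- 4096 ≤ 3^8. The resulting chain makes the bounds linear in the powers.
  have hmul : ∀ k, 3 * X ^ k ≤ X ^ (k + 1) := fun k => by
    rw [pow_succ, mul_comm (X ^ k)]
    exact Nat.mul_le_mul_right _ hX3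
  have h2 : 3 * X ^ 2 ≤ X ^ 3 := hmul 2
  have h3 : 3 * X ^ 3 ≤ X ^ 4 := hmul 3
  have h4 : 3 * X ^ 4 ≤ X ^ 5 := hmul 4
  have h5 : 3 * X ^ 5 ≤ X ^ 6 := hmul 5
  have h6 : 3 * X ^ 6 ≤ X ^ 7 := hmul 6
  have h7 : 3 * X ^ 7 ≤ X ^ 8 := hmul 7
  have h8 : 3 * X ^ 8 ≤ X ^ 9 := hmul 8
  have h9 : 3 * X ^ 9 ≤ X ^ 10 := hmul 9
  have h10 : 3 * X ^ 10 ≤ X ^ 11 := hmul 10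
  have h1 : 3 * X ^ 1 ≤ X ^ 2 := hmul 1
  have h22 : 3 * X ^ 22 ≤ X ^ 23 := hmul 22
  have hX1 : X ^ 1 = X := pow_one X
  have hmono : ∀ k ≤ 29, X ^ k < X ^ 30 := fun k hk => Nat.pow_lt_pow_right (by omega) (by omega)
  have hJ : 2 ^ Nat.clog 2 N ≤ X ^ 3 := by
    rcases Nat.eq_zero_or_pos N with h0 | h0
    · rw [h0]
      simpa using hp 3
    · have := two_pow_clog_le h0
      omega
  have hJ' : Nat.clog 2 N < 2 ^ Nat.clog 2 N := Nat.lt_two_pow_self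
  have hQ : 4096 * 2 ^ Nat.clog 2 N ≤ X ^ 11 := by omega
  refine ⟨?_, ?_, ?_, ?_, ?_⟩
  · have h12 := Nat.mul_le_mul hQ hQ
    have h13 : X ^ 11 * X ^ 11 = X ^ 22 := by ring
    have := hmono 23 (by omega)
    rw [mul_assoc]
    omega
  · have h12 : 44 + 11 * Nat.clog 2 N + 3 ≤ X ^ 7 := by omega
    have h13 : n + 5 ≤ X ^ 3 := by omega
    have h14 := Nat.mul_le_mul h12 h13
    have := hmono 11 (by omega)
    have h15 : X ^ 7 * X ^ 3 = X ^ 10 := by ring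
    omega
  · have := hmono 11 (by omega)
    omega
  · have := hmono 11 (by omega)
    omega
  · have := hmono 11 (by omega)
    omega

/-- With R = n/ε, 4^K is O(R^22), because 4^(11J) = (2^J)^22 and 2^J ≤ 4R for J = `Nat.clog 2 N`.
The time is thus O(n · R^23), well below the claim; the logarithm is only bounded below by log 2. -/
theorem time_bound {n N T : ℕ} {ε : ℝ} (hn : 2 ≤ n) (hε0 : 0 < ε) (hε1 : ε < 1) (hN : 0 < N)
    (hNε : (N : ℝ) ≤ 2 * (n / ε))
    (hT : T ≤ n * ((7 * n + 60) * 4 ^ (44 + 11 * Nat.clog 2 N) + 7 * n + 30) + 1 + 1 +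
      5 * Nat.clog 2 N + 2 + 20) :
    (T : ℝ) ≤ 1000 * 4 ^ 44 * 16 ^ 11 / Real.log 2 *
      ((n : ℝ) ^ 73 / ε ^ 72 * Real.log (n / ε)) := by
  set R : ℝ := n / ε with hR
  have hn' : (2 : ℝ) ≤ n := by exact_mod_cast hn
  have hnR : (n : ℝ) ≤ R := by
    rw [hR, le_div_iff₀ hε0]
    nlinarith
  have hlog2 : 0 < Real.log 2 := Real.log_pos (by norm_num)
  have hlog : Real.log 2 ≤ Real.log R := Real.log_le_log (by norm_num) (by linarith)
  have hpow : (n : ℝ) ^ 73 / ε ^ 72 = n * R ^ 72 := by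
    rw [hR, div_pow, pow_succ' (n : ℝ) 72, mul_div_assoc]
  have h2 : (2 : ℝ) ^ Nat.clog 2 N ≤ 4 * R := by
    have : ((2 ^ Nat.clog 2 N : ℕ) : ℝ) ≤ (2 * N : ℕ) := by exact_mod_cast two_pow_clog_le hN
    push_cast at this
    linarith
  have hJ : (Nat.clog 2 N : ℝ) ≤ 4 * R := by
    have : (Nat.clog 2 N : ℝ) ≤ 2 ^ Nat.clog 2 N := by
      exact_mod_cast (Nat.lt_two_pow_self (n := Nat.clog 2 N)).le
    linarith
  have h4 : (4 : ℝ) ^ (44 + 11 * Nat.clog 2 N) ≤ 4 ^ 44 * 16 ^ 11 * R ^ 22 := by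
    rw [pow_add, mul_assoc]
    gcongr
    calc (4 : ℝ) ^ (11 * Nat.clog 2 N) = (2 ^ Nat.clog 2 N) ^ 22 := by
          rw [show (4 : ℝ) = 2 ^ 2 by norm_num, ← pow_mul, ← pow_mul]
          congr 1
          ring
      _ ≤ (4 * R) ^ 22 := by gcongr
      _ = 16 ^ 11 * R ^ 22 := by rw [mul_pow]; norm_num
  have hR1 : 1 ≤ R := by linarith
  have hR0 : 0 ≤ R := by linarith
  set A : ℝ := 4 ^ 44 * 16 ^ 11 with hA
  have hA1 : 1 ≤ A := by rw [hA]; norm_num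
  have hR23 : R ^ 23 ≤ R ^ 72 := pow_le_pow_right₀ hR1 (by norm_num)
  have hRle : R ≤ R ^ 72 := le_self_pow₀ hR1 (by norm_num)
  have hAR : R ^ 72 ≤ A * R ^ 72 := le_mul_of_one_le_left (by positivity) hA1
  have hT' : (T : ℝ) ≤ n * ((7 * n + 60) * 4 ^ (44 + 11 * Nat.clog 2 N) + 7 * n + 30) + 1 + 1 +
      5 * Nat.clog 2 N + 2 + 20 := by exact_mod_cast hT
  have hmain : (7 * n + 60 : ℝ) * 4 ^ (44 + 11 * Nat.clog 2 N) ≤ 67 * (A * R ^ 72) := by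
    calc (7 * n + 60 : ℝ) * 4 ^ (44 + 11 * Nat.clog 2 N) ≤ (67 * R) * (A * R ^ 22) := by
          gcongr
          linarith
      _ = 67 * (A * R ^ 23) := by ring
      _ ≤ _ := by gcongr
  have hsum : (T : ℝ) ≤ 1000 * A * (n * R ^ 72) := by
    have h5 : (7 * n + 60 : ℝ) * 4 ^ (44 + 11 * Nat.clog 2 N) + 7 * n + 30 ≤
        104 * (A * R ^ 72) := by linarith
    have h6 : (n : ℝ) * ((7 * n + 60) * 4 ^ (44 + 11 * Nat.clog 2 N) + 7 * n + 30) ≤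
        n * (104 * (A * R ^ 72)) := by gcongr
    have h7 : A * R ^ 72 ≤ n * (A * R ^ 72) := le_mul_of_one_le_left (by positivity) (by linarith)
    have h8 : 1000 * A * (n * R ^ 72) = 1000 * (n * (A * R ^ 72)) := by ring
    rw [h8]
    linarith
  calc (T : ℝ) ≤ 1000 * A * (n * R ^ 72) := hsum
    _ = 1000 * A / Real.log 2 * (n * R ^ 72 * Real.log 2) := by field_simp
    _ ≤ 1000 * A / Real.log 2 * (n * R ^ 72 * Real.log R) := by gcongr
    _ = _ := by rw [hpow, hA]; ring

/-- Bernoulli's inequality gives the lower bound. The upper one follows from (1+δ)^n (1-δ)^n ≤ 1 and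
(1+ε)(1-ε/2) ≥ 1. -/
theorem accuracy_bounds {n N : ℕ} {ε : ℝ} (hε : 0 < ε) (hε1 : ε < 1) (hN : 0 < n → 0 < N)
    (hNε : n / ε ≤ N) :
    1 - ε ≤ (1 - 1 / (2 * N : ℝ)) ^ n ∧ (1 + 1 / (2 * N : ℝ)) ^ n ≤ 1 + ε := by
  rcases Nat.eq_zero_or_pos n with rfl | hn
  · simp [hε.le]
  have hN' : (1 : ℝ) ≤ N := by exact_mod_cast hN hn
  set δ : ℝ := 1 / (2 * N) with hδ
  have hδ0 : 0 ≤ δ := by positivity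
  have hδ1 : δ ≤ 1 / 2 := by
    rw [hδ, div_le_iff₀ (by linarith)]
    linarith
  have hnδ : n * δ ≤ ε / 2 := by
    rw [div_le_iff₀ hε] at hNε
    rw [hδ, mul_one_div, div_le_iff₀ (by linarith)]
    linarith
  have hlow : 1 - n * δ ≤ (1 - δ) ^ n := by
    have := one_add_mul_le_pow (a := -δ) (by linarith) n
    rw [← sub_eq_add_neg] at this
    linarith
  refine ⟨by linarith, ?_⟩
  have hprod : (1 + δ) ^ n * (1 - δ) ^ n ≤ 1 := by
    rw [← mul_pow]
    exact pow_le_one₀ (mul_nonneg (by linarith) (by linarith)) (by nlinarith)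
  have hup : (1 + δ) ^ n * (1 - ε / 2) ≤ 1 :=
    (mul_le_mul_of_nonneg_left (by linarith) (by positivity)).trans hprod
  have h1 : 1 ≤ (1 + ε) * (1 - ε / 2) := by nlinarith
  exact le_of_mul_le_mul_right (hup.trans h1) (by linarith)

theorem theorem1 :
    ∃ (P : RAM.Program) (C : ℝ) (K : ℕ),
      ∀ (n m : ℕ) (G : MultiGraph n m) (L : G.AdjList) (a b : ℕ) (ε : ℝ),
        (∀ v, 3 ≤ G.degree v) → ε = (a : ℝ) / (b : ℝ) → 0 < ε → ε < 1 →
        ∃ t : ℕ,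
          RAM.Halted P (RAM.run P (L.encode a b) t) ∧
          RAM.FitsInWords P (L.encode a b) t ((n + m + a + b) ^ K) ∧
          1 - ε ≤ (RAM.run P (L.encode a b) t).output / (G.numSFO : ℝ) ∧
          (RAM.run P (L.encode a b) t).output / (G.numSFO : ℝ) ≤ 1 + ε ∧
          (2 ≤ n → (t : ℝ) ≤ C * ((n : ℝ) ^ 73 / ε ^ 72 * Real.log ((n : ℝ) / ε))) := by
  refine ⟨RAM.counter, 1000 * 4 ^ 44 * 16 ^ 11 / Real.log 2, 30, ?_⟩
  intro n m G L a b ε hdeg hε hε0 hε1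
  have ha : 0 < a := by
    refine Nat.pos_of_ne_zero fun h => ?_
    rw [hε, h] at hε0
    simp at hε0
  have hb : 0 < b := by
    refine Nat.pos_of_ne_zero fun h => ?_
    rw [hε, h] at hε0
    simp at hε0
  have ha' : (0 : ℝ) < a := by exact_mod_cast ha
  have hb' : (0 : ℝ) < b := by exact_mod_cast hb
  have hab : a < b := by
    rw [hε, div_lt_one hb'] at hε1
    exact_mod_cast hε1
  obtain ⟨hB1, hB2, hB3, hB4, hB5⟩ := word_bounds (n := n) (m := m) rfl ha hab rfl
  set B := (n + m + a + b) ^ 30 with hB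
  -- The integer b/a + 1 lies between 1/ε and 2/ε, so N has the order of n/ε. For n = 0 this gives N
  -- = 0, and 1/(2N) is 0 by convention.
  set N := (b / a + 1) * n with hN
  have hinv : 1 / ε = (b : ℝ) / a := by rw [hε, one_div_div]
  have hq1 : 1 / ε ≤ ((b / a + 1 : ℕ) : ℝ) := by
    rw [hinv, div_le_iff₀ ha', mul_comm]
    exact_mod_cast (Nat.lt_mul_div_succ b ha).le
  have hq2 : ((b / a + 1 : ℕ) : ℝ) ≤ 2 * (1 / ε) := by
    have h1 : ((b / a : ℕ) : ℝ) ≤ 1 / ε := by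
      rw [hinv]
      exact Nat.cast_div_le
    have h2 : 1 ≤ 1 / ε := by
      rw [le_div_iff₀ hε0]
      linarith
    push_cast
    linarith
  have hNlo : n / ε ≤ (N : ℝ) := by
    rw [hN, Nat.cast_mul, div_eq_mul_one_div, mul_comm]
    gcongr
  have hNup : (N : ℝ) ≤ 2 * (n / ε) := by
    rw [hN, Nat.cast_mul, div_eq_mul_one_div (n : ℝ), mul_left_comm, mul_comm]
    gcongr
  have hNpos : 0 < n → 0 < N := fun h => Nat.mul_pos (Nat.succ_pos _) h
  have hpow := Nat.one_le_two_pow (n := Nat.clog 2 N)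
  have hoff := L.offset_eq
  have hle : 3 * (n + 5) ≤ (44 + 11 * Nat.clog 2 N + 3) * (n + 5) :=
    Nat.mul_le_mul_right _ (by omega)
  have hK : 44 + 11 * Nat.clog 2 N + 3 ≤ (44 + 11 * Nat.clog 2 N + 3) * (n + 5) :=
    Nat.le_mul_of_pos_right _ (by omega)
  have hQ2 : 2 * (4096 * 2 ^ Nat.clog 2 N) ≤
      2 * (4096 * 2 ^ Nat.clog 2 N) * (4096 * 2 ^ Nat.clog 2 N) :=
    Nat.le_mul_of_pos_right _ (by omega)
  have h_init_eq : MultiGraph.Accurate G (4096 * 2 ^ Nat.clog 2 N) (1 / (2 * N : ℝ)) 0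
      (MultiGraph.below n 0) (4096 * 2 ^ Nat.clog 2 N) (12 + Nat.clog 2 N) := by
    have h1 : MultiGraph.below n 0 = ∅ := by simp [MultiGraph.below]
    have h2 : ((4096 * 2 ^ Nat.clog 2 N : ℕ) : ℝ) * 2 ^ m / 2 ^ (12 + Nat.clog 2 N) = 2 ^ m := by
      push_cast
      rw [pow_add]
      norm_num
    refine ⟨le_rfl, by omega, ?_, ?_⟩ <;> rw [h1, h2, G.avoid_empty] <;> simp
  have hδ : (1 / (2 * N : ℝ)) ≤ 1 := by
    rcases Nat.eq_zero_or_pos N with h | h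
    · simp [h]
    · have : (1 : ℝ) ≤ N := by exact_mod_cast h
      rw [div_le_one (by linarith)]
      linarith
  have hKB : 44 + 11 * Nat.clog 2 N < B := by omega
  have hok := RAM.ok_start (B := B) (a := a) (b := b) L (hQ2.trans_lt hB1) hKB (by omega)
    (by omega) hB4 fun t s =>
      RAM.ok_main_loop (G := G) (L := L) (δ := 1 / (2 * N : ℝ)) (F₀ := 12 + Nat.clog 2 N) hdeg
        (L.holds a b) (by omega) hδ (fun h => per_vertex_error_le (hNpos h)) hB1
        (by rw [hoff]; exact hB2) hB3 n 0 _ _ _ _ _ _ _ _ t s _ _ (by omega) le_rfl h_init_eq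
        (fun _ _ => rfl) (fun w _ => by rw [L.memory_of_le a b (by omega)]; simp)
  have hfits : RAM.Fits B (RAM.init (L.encode a b)) := fun i =>
    ⟨by simp only [RAM.init]; omega,
      L.memory_lt (by omega) (by omega) (by omega) (by omega) (by rw [hoff]; omega) i⟩
  obtain ⟨t, ht, ⟨hhalt, hm, hacc⟩, hfit⟩ := hok hfits
  have hZ : (0 : ℝ) < G.numSFO := by
    rw [← G.avoid_univ]
    exact G.avoid_pos hdeg _
  have hlower := hacc.lower
  have hupper := hacc.upper
  rw [G.avoid_univ] at hlower hupper
  obtain ⟨hacc1, hacc2⟩ := accuracy_bounds hε0 hε1 hNpos hNlo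
  have hout : (RAM.run RAM.counter (L.encode a b) t).output =
      ((RAM.step RAM.counter)^[t] (RAM.init (L.encode a b))).reg 0 * 2 ^ m /
        2 ^ ((RAM.step RAM.counter)^[t] (RAM.init (L.encode a b))).reg 2 := by
    rw [RAM.run, RAM.Config.output, hm]
  refine ⟨t, hhalt, hfit, ?_, ?_, fun hn => ?_⟩
  · rw [hout, le_div_iff₀ hZ]
    exact (mul_le_mul_of_nonneg_right hacc1 hZ.le).trans hlower
  · rw [hout, div_le_iff₀ hZ]
    exact hupper.trans (mul_le_mul_of_nonneg_right hacc2 hZ.le)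
  · exact time_bound hn hε0 hε1 (hNpos (by omega)) hNup ht
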